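/- **Setting.** Let $\phi,\psi:\mathbb R\to\mathbb R$ be measurable and compactly supported, $\psi$ bounded, and write $g_{j,k}(x)=\sum_{r\in\mathbb Z}2^{j/2}g(2^j(x-r)-k)$ for the periodized wavelets ($g=\phi,\psi$). Let $\tau\ge 0$ be an integer such that $\{\phi_{\tau,k}:0\le k<2^\tau\}\cup\{\psi_{j,k}:j\ge\tau,\ 0\le k<2^j\}$ is an orthonormal basis of $L^2([0,1])$. For $f\in L^2([0,1])$ put $\alpha_{j,k}=\int_0^1 f\phi_{j,k}$, $\beta_{j,k}=\int_0^1 f\psi_{j,k}$. For $L>0$, $s>0$ and $p,q\in[1,\infty]$, the Besov ball $B^s_{p,q}(L)$ is the set of $f\in L^2([0,1])$ such that $$\Big[\big(2^{(\tau-1)(s+\frac12-\frac1p)}\|(\alpha_{\tau,k})_{0\le k<2^\tau}\|_{\ell^p}\big)^q+\sum_{j\ge\tau}\big(2^{j(s+\frac12-\frac1p)}\|(\beta_{j,k})_{0\le k<2^j}\|_{\ell^p}\big)^q\Big]^{1/q}\le L,$$ with the usual modification for $q=\infty$ (and $1/\infty=0$). *Model.* $D_n=((X_i,Y_i))_{1\le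 i\le n}$ are i.i.d. with the law $\pi$ of $(X,Y)$, where $X$ is uniform on $[0,1]$, $Y\in[0,1]$ almost surely, and $f^*(X)=\mathbb E[Y\mid X]$. *Thresholding rule.* $\Upsilon_u:\mathbb R\to\mathbb R$ ($u\ge0$) are measurable and there are constants $C_1,C_2>0$ with $$|\Upsilon_u(x)-y|^2\le C_1\big(\min(|y|,C_2u)^2+|x-y|^2\mathbf 1_{\{|x-y|\ge u/2\}}\big)\qquad(u\ge 0,\ x,y\in\mathbb R)$$ (for instance hard, soft or non-negative garrote thresholding). *Estimator.* For $n\ge 6$ let $l=\lceil n/\log n\rceil$ and $m=n-l$ (so $m\ge2$); let $D_m$ be the first $m$ observations, and let $j_1$ be the integer with $m/\log m\le 2^{j_1}<2m/\log m$. Put $$\hat\alpha_{j,k}=\frac1m\sum_{i=1}^mY_i\phi_{j,k}(X_i),\qquad \hat\beta_{j,k}=\frac1m\sum_{i=1}^mY_i\psi_{j,k}(X_i),$$ and, for $u\in\Lambda_n=\{0,1,\dots,\lfloor\log_2n\rfloor\}$, $$\hat f_u(x)=\sum_{k=0}^{2^\tau-1}\hat\alpha_{\tau,k}\phi_{\tau,k}(x)+\sum_{j=\tau}^{j_1}\sum_{k=0}^{2^j-1}\Upsilon_{\lambda_{j}^{(u)}}(\hat\beta_{j,k})\,\psi_{j,k}(x),\qquad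 \lambda_{j}^{(u)}=\rho\sqrt{\frac{(j-u)_+}{m}} .$$ Let $h(y)=\max(0,\min(y,1))$ and $A^{(l)}(g)=\frac1l\sum_{i=m+1}^n(Y_i-g(X_i))^2$. The multi-thresholding estimator is $$\tilde f_n(x)=\sum_{u\in\Lambda_n}w_u\,h(\hat f_u(x)),\qquad w_u=\frac{\exp(-lA^{(l)}(h(\hat f_u)))}{\sum_{v\in\Lambda_n}\exp(-lA^{(l)}(h(\hat f_v)))}.$$ **Theorem.** Let $\rho>0$ satisfy $$\frac{\rho^2}{8+\frac{8\rho}{3\sqrt2}(\|\psi\|_\infty+1)}\ge 4\log 2,$$ where $\|\psi\|_\infty$ is the $L^\infty(\mathbb R)$ norm. Let $N$ be a real number, $L>0$ and $s_0>0$. Then there is a constant $C>0$, depending only on $\phi,\psi,\tau,\Upsilon,\rho,N,L,s_0$, such that for all $p,q\in[1,\infty]$, all $s\in(1/p,N]$ with $s\ge s_0$, and every integer $n\ge 6$, $$\sup\ \mathbb E\big[\|\tilde f_n-f^*\|^2_{L^2([0,1])}\big]\le C\,n^{-2s/(2s+1)},$$ the supremum being over all laws $\pi$ as above whose regression function $f^*$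 belongs to $B^s_{p,q}(L)$. -/

import Mathlib

open MeasureTheory Set
open scoped ENNReal

noncomputable section

/-! ### Periodized wavelets and Besov balls on the unit interval -/

/-- Lebesgue measure on `[0,1]`. -/
def unitVolume : Measure ℝ := volume.restrict (Icc 0 1)

/-- `g_{j,k}(x) = 2^{j/2} g (2^j x - k)`. -/
def dilate (g : ℝ → ℝ) (j k : ℕ) (x : ℝ) : ℝ :=
  (2 : ℝ) ^ ((j : ℝ) / 2) * g (2 ^ j * x - k)

/-- The periodization `∑_{l ∈ ℤ} g_{j,k}(x - l)`. -/
def perWavelet (g : ℝ → ℝ) (j k : ℕ) (x : ℝ) : ℝ :=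
  ∑' l : ℤ, dilate g j k (x - l)

/-- Indices of the periodized basis with coarsest level `τ`: `Sum.inl k` stands for the father
wavelet `φ_{τ,k}`, and `Sum.inr ⟨i, k⟩` for the mother wavelet `ψ_{τ+i,k}`. -/
abbrev WaveletIndex (τ : ℕ) : Type := Fin (2 ^ τ) ⊕ (Σ i : ℕ, Fin (2 ^ (τ + i)))

/-- The periodized wavelet with a given index. -/
def waveletFun (φ ψ : ℝ → ℝ) (τ : ℕ) : WaveletIndex τ → ℝ → ℝ
  | Sum.inl k => perWavelet φ τ k
  | Sum.inr ⟨i, k⟩ => perWavelet ψ (τ + i) k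

/-- `φ` and `ψ` are compactly supported, `ψ` is (essentially) bounded, and `τ` is a level from
which the periodized wavelets form an orthonormal basis of `L²([0,1])`. -/
structure IsPeriodizedWaveletBasis (φ ψ : ℝ → ℝ) (τ : ℕ) : Prop where
  measurable_father : Measurable φ
  measurable_mother : Measurable ψ
  compact_father : HasCompactSupport φ
  compact_mother : HasCompactSupport ψ
  bounded_mother : MemLp ψ ∞ volume
  orthonormal_basis :
    ∃ b : HilbertBasis (WaveletIndex τ) ℝ (Lp ℝ 2 unitVolume),
      ∀ i, (b i : ℝ → ℝ) =ᵐ[unitVolume] waveletFun φ ψ τ i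

/-- `‖g‖_∞` for the Lebesgue measure on the line. -/
def supNorm (g : ℝ → ℝ) : ℝ := (eLpNorm g ∞ volume).toReal

/-- The coefficient `∫_0^1 f(x) g^{per}_{j,k}(x) dx`. -/
def waveletCoeff (g f : ℝ → ℝ) (j k : ℕ) : ℝ :=
  ∫ x, f x * perWavelet g j k x ∂unitVolume

/-- The `ℓ^p` norm of a family, with values in `[0,∞]`, for `p ∈ [1,∞]`. -/
def seqNorm {ι : Type*} (p : ℝ≥0∞) (a : ι → ℝ≥0∞) : ℝ≥0∞ :=
  if p = ∞ then ⨆ i, a i else (∑' i, a i ^ p.toReal) ^ (p.toReal⁻¹)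

/-- `2^{j(s+1/2-1/p)}`, with `1/∞ = 0`. -/
def besovWeight (s : ℝ) (p : ℝ≥0∞) (j : ℝ) : ℝ≥0∞ :=
  ENNReal.ofReal ((2 : ℝ) ^ (j * (s + 1 / 2 - (p⁻¹).toReal)))

/-- The level terms of the Besov norm: position `0` is level `τ - 1`, which holds the father
coefficients `α_{τ,k}`; position `i + 1` is level `τ + i`, which holds the `β_{τ+i,k}`. -/
def besovTerm (φ ψ : ℝ → ℝ) (τ : ℕ) (s : ℝ) (p : ℝ≥0∞) (f : ℝ → ℝ) : ℕ → ℝ≥0∞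
  | 0 => besovWeight s p ((τ : ℝ) - 1) *
      seqNorm p (fun k : Fin (2 ^ τ) => ‖waveletCoeff φ f τ k‖ₑ)
  | i + 1 => besovWeight s p ((τ + i : ℕ) : ℝ) *
      seqNorm p (fun k : Fin (2 ^ (τ + i)) => ‖waveletCoeff ψ f (τ + i) k‖ₑ)

/-- The Besov ball `B^s_{p,q}(L)`, described by wavelet coefficients. -/
def besovBall (φ ψ : ℝ → ℝ) (τ : ℕ) (s : ℝ) (p q : ℝ≥0∞) (L : ℝ) : Set (ℝ → ℝ) :=
  {f | MemLp f 2 unitVolume ∧ seqNorm q (besovTerm φ ψ τ s p f) ≤ ENNReal.ofReal L}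

/-! ### The regression model -/

/-- Bounded regression with uniform random design: `π` is the law of a pair `(X, Y)` with `X`
uniform on `[0,1]` and `Y ∈ [0,1]` almost surely, and `f` is a version of the regression
function, `E[Y | X] = f(X)`. -/
structure IsBoundedRegression (π : Measure (ℝ × ℝ)) (f : ℝ → ℝ) : Prop where
  isProbability : IsProbabilityMeasure π
  uniform_design : π.map Prod.fst = unitVolume
  bounded_response : ∀ᵐ z ∂π, z.2 ∈ Icc (0 : ℝ) 1
  measurable_regression : Measurable f
  regression :
    π[(Prod.snd : ℝ × ℝ → ℝ) | MeasurableSpace.comap (Prod.fst : ℝ × ℝ → ℝ) inferInstance]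
      =ᵐ[π] fun z => f z.1

/-! ### Term-by-term thresholding -/

/-- A thresholding rule `Υ`, where `Υ u x` is the value at `x` for the threshold `u ≥ 0`. -/
def IsThresholdRule (Υ : ℝ → ℝ → ℝ) : Prop :=
  (∀ u, 0 ≤ u → Measurable (Υ u)) ∧
  ∃ C₁ C₂ : ℝ, 0 < C₁ ∧ 0 < C₂ ∧ ∀ u, 0 ≤ u → ∀ x y : ℝ,
    |Υ u x - y| ^ 2 ≤
      C₁ * (min |y| (C₂ * u) ^ 2 + (if u / 2 ≤ |x - y| then |x - y| ^ 2 else 0))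

/-- The coefficient estimate `(1/m) ∑_i Y_i g^{per}_{j,k}(X_i)`. -/
def coeffEstimate (g : ℝ → ℝ) {m : ℕ} (D : Fin m → ℝ × ℝ) (j k : ℕ) : ℝ :=
  (1 / (m : ℝ)) * ∑ i, (D i).2 * perWavelet g j k (D i).1

/-- The thresholded estimator built on a sample of size `m`, with threshold `lam j` at level
`j` and finest level `j₁`. -/
def thresholdEstimator (φ ψ : ℝ → ℝ) (τ : ℕ) (Υ : ℝ → ℝ → ℝ) (j₁ : ℕ) (lam : ℕ → ℝ)
    {m : ℕ} (D : Fin m → ℝ × ℝ) (x : ℝ) : ℝ :=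
  ∑ k ∈ Finset.range (2 ^ τ), coeffEstimate φ D τ k * perWavelet φ τ k x +
  ∑ j ∈ Finset.Icc τ j₁, ∑ k ∈ Finset.range (2 ^ j),
    Υ (lam j) (coeffEstimate ψ D j k) * perWavelet ψ j k x

/-- The thresholds `v_u = (ρ √((j-u)₊ / m))_j` (the subtraction in `ℕ` is the positive part). -/
def levelThreshold (ρ : ℝ) (m u j : ℕ) : ℝ := ρ * Real.sqrt (((j - u : ℕ) : ℝ) / m)

/-! ### The multi-thresholding estimator -/

/-- Size `l = ⌈n / log n⌉` of the learning sample. -/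
def learnSize (n : ℕ) : ℕ := ⌈(n : ℝ) / Real.log n⌉₊

/-- Size `m = n - l` of the training sample. -/
def trainSize (n : ℕ) : ℕ := n - learnSize n

/-- The first `m` observations. -/
def trainSample {n : ℕ} (D : Fin n → ℝ × ℝ) : Fin (trainSize n) → ℝ × ℝ :=
  fun i => D (Fin.castLE (Nat.sub_le n (learnSize n)) i)

/-- The projection `h_{a,b}(y) = max(a, min(y, b))`. -/
def clip (a b y : ℝ) : ℝ := max a (min y b)

/-- The empirical squared risk of `g` over the last `l` observations. -/
def learnRisk {n : ℕ} (D : Fin n → ℝ × ℝ) (g : ℝ → ℝ) : ℝ :=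
  (1 / (learnSize n : ℝ)) *
    ∑ i ∈ Finset.univ.filter (fun i : Fin n => trainSize n ≤ (i : ℕ)), ((D i).2 - g (D i).1) ^ 2

/-- The index set `{0, …, ⌊log₂ n⌋}`. -/
def levelGrid (n : ℕ) : Finset ℕ := Finset.range (Nat.log 2 n + 1)

/-- The clipped training estimators `h_{0,1}(f̂_{v_u}(D_m, ·))`. -/
def baseEstimator (φ ψ : ℝ → ℝ) (τ : ℕ) (Υ : ℝ → ℝ → ℝ) (ρ : ℝ) (j₁ : ℕ)
    {n : ℕ} (D : Fin n → ℝ × ℝ) (u : ℕ) (x : ℝ) : ℝ :=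
  clip 0 1 (thresholdEstimator φ ψ τ Υ j₁ (levelThreshold ρ (trainSize n) u) (trainSample D) x)

/-- The exponential weights over the grid. -/
def aggWeight (φ ψ : ℝ → ℝ) (τ : ℕ) (Υ : ℝ → ℝ → ℝ) (ρ : ℝ) (j₁ : ℕ)
    {n : ℕ} (D : Fin n → ℝ × ℝ) (u : ℕ) : ℝ :=
  Real.exp (-(learnSize n : ℝ) * learnRisk D (baseEstimator φ ψ τ Υ ρ j₁ D u)) /
    ∑ v ∈ levelGrid n,
      Real.exp (-(learnSize n : ℝ) * learnRisk D (baseEstimator φ ψ τ Υ ρ j₁ D v))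

/-- The multi-thresholding estimator. -/
def multiThresholdEstimator (φ ψ : ℝ → ℝ) (τ : ℕ) (Υ : ℝ → ℝ → ℝ) (ρ : ℝ) (j₁ : ℕ)
    {n : ℕ} (D : Fin n → ℝ × ℝ) (x : ℝ) : ℝ :=
  ∑ u ∈ levelGrid n,
    aggWeight φ ψ τ Υ ρ j₁ D u * baseEstimator φ ψ τ Υ ρ j₁ D u x

/-- The risk `E ‖f̃_n - f‖²_{L²([0,1])}` for `n` independent observations with law `π`. -/
def estimationRisk (π : Measure (ℝ × ℝ)) (n : ℕ) (f : ℝ → ℝ)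
    (est : (Fin n → ℝ × ℝ) → ℝ → ℝ) : ℝ≥0∞ :=
  ∫⁻ D, ∫⁻ x, ENNReal.ofReal ((est D x - f x) ^ 2) ∂unitVolume ∂(Measure.pi fun _ : Fin n => π)

end

/-! Conditionally on the training sample, the clipped estimators are fixed `[0,1]`-valued functions,
and exponential weighting on the learning sample is nearly as good as the best of them. So it
suffices that one element of the grid attains the rate, and that element may depend on the unknown
`s`. It is the `u` with `2^u ≤ n^(1/(2s+1)) ≤ 2^(u+1)`, the level where bias and variance balance.

Aggregation (`lintegral_softmax_le`). The excess loss `ξ` of `g` is bounded, has mean `R = ‖g - f‖²`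
and satisfies `E ξ² ≤ 4R`. This Bernstein condition gives `E exp((R - 2ξ)/16) ≤ 1`, which tensorizes
over the learning sample. The aggregate then has risk at most `2 R(u₀) + 18 |Λ| / l` for every `u₀`
in the grid `Λ`. The remainder is of order `(log n)² / n`, below the rate when `s ≤ N`.

Thresholding (`lintegral_thresholdEstimator_le`). Parseval's identity splits the risk into levels
`j`. For `j ≤ u` the threshold is zero: there is no bias, and the `2^j` coefficients each cost at
most a constant times `1/m`; these sum to `2^u / m`, the rate. For `u < j ≤ j₁` the condition on `ρ`
makes large noise so rare that a coefficient costs `2^(-5(j-u)/4) / m`, which beats the number `2^j`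
of coefficients, apart from finitely many low levels treated crudely. The bias `∑ min(|β|, C₂ λ)²`
is controlled by `∑ β²` when `p ≥ 2`, and by `λ^(2-p) ∑ |β|^p` when `p < 2`. For `j > j₁` only `∑
β²` remains; it is small because `2^(-j₁)` is of order `log n / n` and, when `p < 2`, because `s >
1/p`. Each bound is the rate times a sequence summable in `j`, with sum independent of `u` and `j₁`
(`levelProfile`). The bounds `s₀ ≤ s ≤ N` make the constants uniform: `s₀` gives geometric decay,
`N` absorbs logarithms and constants raised to the power `2s`. -/

/-! ### Splitting a sample -/

/-- Concatenation of two samples. -/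
def joinSample {α : Type*} {m l n : ℕ} (h : m + l = n) (D : (Fin m → α) × (Fin l → α)) :
    Fin n → α :=
  fun i => Fin.append D.1 D.2 (Fin.cast h.symm i)

theorem measurePreserving_joinSample {α : Type*} [MeasurableSpace α] {m l n : ℕ} (h : m + l = n)
    (π : Measure α) [IsProbabilityMeasure π] :
    MeasurePreserving (joinSample h)
      ((Measure.pi fun _ : Fin m => π).prod (Measure.pi fun _ : Fin l => π))
      (Measure.pi fun _ : Fin n => π) := by
  subst h
  have hmeas : Measurable (joinSample (α := α) (m := m) (l := l) rfl) := by
    refine measurable_pi_lambda _ fun i => ?_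
    simp only [joinSample, Fin.cast_eq_self]
    refine Fin.addCases (fun i => ?_) (fun i => ?_) i
    · simp only [Fin.append_left]; fun_prop
    · simp only [Fin.append_right]; fun_prop
  refine ⟨hmeas, (Measure.pi_eq fun s hs => ?_).symm⟩
  rw [Measure.map_apply hmeas (MeasurableSet.univ_pi hs)]
  have : joinSample (α := α) (m := m) (l := l) rfl ⁻¹' (univ.pi s) =
      (univ.pi fun i => s (Fin.castAdd l i)) ×ˢ (univ.pi fun i => s (Fin.natAdd m i)) := by
    ext D
    simp only [mem_preimage, mem_univ_pi, mem_prod, joinSample, Fin.cast_eq_self]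
    constructor
    · intro H
      exact ⟨fun i => by simpa using H (Fin.castAdd l i), fun i => by simpa using H (Fin.natAdd m i)⟩
    · rintro ⟨H1, H2⟩ i
      refine Fin.addCases (fun i => ?_) (fun i => ?_) i
      · simpa using H1 i
      · simpa using H2 i
  rw [this, Measure.prod_prod, Measure.pi_pi, Measure.pi_pi, Fin.prod_univ_add]

theorem lintegral_pi_le_of_joinSample {α : Type*} [MeasurableSpace α] {m l n : ℕ} (h : m + l = n)
    (π : Measure α) [IsProbabilityMeasure π] (F : (Fin n → α) → ℝ≥0∞) (G : (Fin m → α) → ℝ≥0∞)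
    (hFG : ∀ D₁, ∫⁻ D₂, F (joinSample h (D₁, D₂)) ∂(Measure.pi fun _ : Fin l => π) ≤ G D₁) :
    ∫⁻ D, F D ∂(Measure.pi fun _ : Fin n => π) ≤ ∫⁻ D₁, G D₁ ∂(Measure.pi fun _ : Fin m => π) := by
  have hp := measurePreserving_joinSample h π
  -- `F` need not be measurable: its lower integral is attained by a measurable minorant, to which
  -- Tonelli's theorem applies.
  obtain ⟨F', hF', hle, heq⟩ := exists_measurable_le_lintegral_eq (Measure.pi fun _ : Fin n => π) F
  rw [heq, ← hp.lintegral_comp hF',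
    lintegral_prod (fun D => F' (joinSample h D)) (hF'.comp hp.measurable).aemeasurable]
  exact lintegral_mono fun D₁ => (lintegral_mono fun D₂ => hle _).trans (hFG D₁)

/-! ### Exponential weights -/

theorem mul_exp_neg_le_one (x : ℝ) : x * Real.exp (-x) ≤ 1 := by
  rw [Real.exp_neg, ← div_eq_mul_inv, div_le_one (Real.exp_pos x)]
  linarith [Real.add_one_le_exp x]

/-- Since the normalization is at least `exp(-l A u₀)`, the weight of `u` is at most `exp(-l (A u -
A u₀))`. Then `x e^(-x) ≤ 1` bounds each contribution by `1/l`. The loss of `card / l` instead of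
`log card / l` is harmless for a grid of logarithmic size. -/
theorem sum_softmax_mul_le {ι : Type*} (s : Finset ι) (A : ι → ℝ) {l : ℝ} (hl : 0 < l) {u₀ : ι}
    (hu₀ : u₀ ∈ s) :
    ∑ u ∈ s, Real.exp (-l * A u) / (∑ v ∈ s, Real.exp (-l * A v)) * A u ≤ A u₀ + s.card / l := by
  set Z := ∑ v ∈ s, Real.exp (-l * A v) with hZ
  have hZpos : 0 < Z := Finset.sum_pos (fun i _ => Real.exp_pos _) ⟨u₀, hu₀⟩
  have hZ0 : Real.exp (-l * A u₀) ≤ Z :=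
    Finset.single_le_sum (f := fun v => Real.exp (-l * A v)) (fun i _ => (Real.exp_pos _).le) hu₀
  have hsum : ∑ u ∈ s, Real.exp (-l * A u) / Z = 1 := by
    rw [← Finset.sum_div, div_self hZpos.ne']
  have key : ∀ u ∈ s, Real.exp (-l * A u) / Z * (A u - A u₀) ≤ 1 / l := by
    intro u _
    rcases le_total (A u - A u₀) 0 with h | h
    · exact (mul_nonpos_of_nonneg_of_nonpos (by positivity) h).trans (by positivity)
    · have h1 : Real.exp (-l * A u) / Z ≤ Real.exp (-(l * (A u - A u₀))) := by
        rw [div_le_iff₀ hZpos]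
        calc Real.exp (-l * A u) = Real.exp (-(l * (A u - A u₀))) * Real.exp (-l * A u₀) := by
              rw [← Real.exp_add]; ring_nf
          _ ≤ _ := by gcongr
      calc _ ≤ Real.exp (-(l * (A u - A u₀))) * (A u - A u₀) := by gcongr
        _ = (l * (A u - A u₀) * Real.exp (-(l * (A u - A u₀)))) / l := by field_simp
        _ ≤ 1 / l := by gcongr; exact mul_exp_neg_le_one _
  have := Finset.sum_le_sum key
  simp only [mul_sub, Finset.sum_sub_distrib, ← Finset.sum_mul, hsum, Finset.sum_const,
    nsmul_eq_mul] at this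
  rw [mul_one_div] at this
  linarith

theorem sq_sum_mul_sub_le {ι : Type*} (s : Finset ι) (w g : ι → ℝ) (y : ℝ)
    (hw : ∀ i ∈ s, 0 ≤ w i) (hw1 : ∑ i ∈ s, w i = 1) :
    (∑ i ∈ s, w i * g i - y) ^ 2 ≤ ∑ i ∈ s, w i * (g i - y) ^ 2 := by
  have h := (even_two.convexOn_pow (𝕜 := ℝ)).map_sum_le (t := s) (w := w) (p := fun i => g i - y)
    hw hw1 (fun _ _ => mem_univ _)
  have h1 : ∑ i ∈ s, w i • (g i - y) = ∑ i ∈ s, w i * g i - y := by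
    simp only [smul_eq_mul, mul_sub, Finset.sum_sub_distrib, ← Finset.sum_mul, hw1, one_mul]
  rwa [h1] at h

theorem le_mul_exp_div (a : ℝ) {c : ℝ} (hc : 0 < c) : a ≤ c * Real.exp (a / c) := by
  have : a / c ≤ Real.exp (a / c) := by linarith [Real.add_one_le_exp (a / c)]
  rwa [div_le_iff₀' hc] at this

/-- Deterministic core of the oracle inequality for exponential weights. -/
theorem sum_softmax_risk_le {ι : Type*} (s : Finset ι) (A R : ι → ℝ) (B : ℝ) {l : ℝ} (hl : 0 < l)
    {u₀ : ι} (hu₀ : u₀ ∈ s) :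
    ∑ u ∈ s, Real.exp (-l * A u) / (∑ v ∈ s, Real.exp (-l * A v)) * R u ≤
      ∑ u ∈ s, 16 / l * Real.exp (l * (R u - 2 * (A u - B)) / 16) + 2 * (A u₀ - B)
        + 2 * (s.card / l) := by
  set Z := ∑ v ∈ s, Real.exp (-l * A v) with hZ
  have hZpos : 0 < Z := Finset.sum_pos (fun i _ => Real.exp_pos _) ⟨u₀, hu₀⟩
  have hsum : ∑ u ∈ s, Real.exp (-l * A u) / Z = 1 := by
    rw [← Finset.sum_div, div_self hZpos.ne']
  have hw1 : ∀ u ∈ s, Real.exp (-l * A u) / Z ≤ 1 := fun u hu => by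
    rw [div_le_one hZpos]
    exact Finset.single_le_sum (f := fun v => Real.exp (-l * A v))
      (fun i _ => (Real.exp_pos _).le) hu
  have h1 := sum_softmax_mul_le s A hl hu₀
  -- The inequality `a ≤ c e^(a/c)` with `c = 16/l` produces an exponential of controlled mean.
  -- Bounding the weights by one afterwards removes their dependence on the data.
  have h2 : ∑ u ∈ s, Real.exp (-l * A u) / Z * (R u - 2 * (A u - B)) ≤
      ∑ u ∈ s, 16 / l * Real.exp (l * (R u - 2 * (A u - B)) / 16) := by
    refine Finset.sum_le_sum fun u hu => ?_
    have h3 := le_mul_exp_div (R u - 2 * (A u - B)) (c := 16 / l) (by positivity)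
    have h4 : (R u - 2 * (A u - B)) / (16 / l) = l * (R u - 2 * (A u - B)) / 16 := by
      field_simp
    rw [h4] at h3
    calc _ ≤ Real.exp (-l * A u) / Z * (16 / l * Real.exp (l * (R u - 2 * (A u - B)) / 16)) := by
          gcongr
      _ ≤ 1 * (16 / l * Real.exp (l * (R u - 2 * (A u - B)) / 16)) := by
          gcongr; exact hw1 u hu
      _ = _ := one_mul _
  have h5 : ∑ u ∈ s, Real.exp (-l * A u) / Z * (R u - 2 * (A u - B)) =
      ∑ u ∈ s, Real.exp (-l * A u) / Z * R u - 2 * ∑ u ∈ s, Real.exp (-l * A u) / Z * A u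
        + 2 * B := by
    have : ∀ u, Real.exp (-l * A u) / Z * (R u - 2 * (A u - B)) =
      Real.exp (-l * A u) / Z * R u - 2 * (Real.exp (-l * A u) / Z * A u)
        + (Real.exp (-l * A u) / Z) * (2 * B) := fun u => by ring
    simp only [this, Finset.sum_add_distrib, Finset.sum_sub_distrib, ← Finset.mul_sum,
      ← Finset.sum_mul, hsum, one_mul]
  linarith

/-! ### Regression with bounded response -/

namespace IsBoundedRegression

variable {π : Measure (ℝ × ℝ)} {f : ℝ → ℝ}

theorem ae_fst (h : IsBoundedRegression π f) {p : ℝ → Prop} (hp : ∀ᵐ x ∂unitVolume, p x) :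
    ∀ᵐ z ∂π, p z.1 := by
  rw [← h.uniform_design] at hp
  exact ae_of_ae_map measurable_fst.aemeasurable hp

theorem integrable_snd (h : IsBoundedRegression π f) : Integrable (Prod.snd : ℝ × ℝ → ℝ) π := by
  have := h.isProbability
  refine Integrable.of_mem_Icc 0 1 measurable_snd.aemeasurable h.bounded_response

theorem regression_mem_Icc (h : IsBoundedRegression π f) :
    ∀ᵐ x ∂unitVolume, f x ∈ Icc (0 : ℝ) 1 := by
  have := h.isProbability
  have hle : MeasurableSpace.comap (Prod.fst : ℝ × ℝ → ℝ) inferInstance ≤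
      (inferInstance : MeasurableSpace (ℝ × ℝ)) := measurable_fst.comap_le
  have h0 := condExp_nonneg (m := MeasurableSpace.comap (Prod.fst : ℝ × ℝ → ℝ) inferInstance)
    (μ := π) (f := Prod.snd) (h.bounded_response.mono fun z hz => hz.1)
  have h1 := condExp_mono (m := MeasurableSpace.comap (Prod.fst : ℝ × ℝ → ℝ) inferInstance)
    (μ := π) h.integrable_snd (integrable_const (1 : ℝ)) (h.bounded_response.mono fun z hz => hz.2)
  rw [condExp_const hle] at h1
  rw [← h.uniform_design, ae_map_iff measurable_fst.aemeasurable
    (h.measurable_regression measurableSet_Icc)]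
  filter_upwards [h0, h1, h.regression] with z hz0 hz1 hz
  rw [hz] at hz0 hz1
  exact ⟨hz0, hz1⟩

theorem integral_fst (h : IsBoundedRegression π f) {g : ℝ → ℝ} (hg : Measurable g) :
    ∫ z, g z.1 ∂π = ∫ x, g x ∂unitVolume := by
  rw [← h.uniform_design, integral_map measurable_fst.aemeasurable hg.aestronglyMeasurable]

theorem integrable_fst (h : IsBoundedRegression π f) {g : ℝ → ℝ} (hg : Measurable g)
    (hi : Integrable g unitVolume) : Integrable (fun z => g z.1) π := by
  rw [← h.uniform_design, integrable_map_measure hg.aestronglyMeasurable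
    measurable_fst.aemeasurable] at hi
  exact hi

theorem integrable_snd_mul_fst (h : IsBoundedRegression π f) {g : ℝ → ℝ} (hg : Measurable g)
    (hi : Integrable g unitVolume) : Integrable (fun z => z.2 * g z.1) π := by
  refine (h.integrable_fst hg hi).mono (by fun_prop) ?_
  filter_upwards [h.bounded_response] with z hz
  rw [norm_mul]
  refine mul_le_of_le_one_left (norm_nonneg _) ?_
  rw [Real.norm_eq_abs, abs_le]; constructor <;> linarith [hz.1, hz.2]

/-- The factor `g(X)` is measurable for the conditioning σ-algebra and comes out of the conditional
expectation. This makes the empirical coefficients unbiased and removes the cross term of the excess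
loss. -/
theorem integral_snd_mul_fst (h : IsBoundedRegression π f) {g : ℝ → ℝ} (hg : Measurable g)
    (hi : Integrable g unitVolume) :
    ∫ z, z.2 * g z.1 ∂π = ∫ x, f x * g x ∂unitVolume := by
  have := h.isProbability
  have hle : MeasurableSpace.comap (Prod.fst : ℝ × ℝ → ℝ) inferInstance ≤
      (inferInstance : MeasurableSpace (ℝ × ℝ)) := measurable_fst.comap_le
  have hsm : StronglyMeasurable[MeasurableSpace.comap (Prod.fst : ℝ × ℝ → ℝ) inferInstance]
      (fun z : ℝ × ℝ => g z.1) := by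
    exact (hg.comp (comap_measurable _)).stronglyMeasurable
  have hint := h.integrable_snd_mul_fst hg hi
  have h1 := condExp_mul_of_stronglyMeasurable_left (μ := π) (g := Prod.snd) hsm
    (hint.congr (Filter.Eventually.of_forall fun z => mul_comm _ _)) h.integrable_snd
  rw [← h.integral_fst (g := fun x => f x * g x) (h.measurable_regression.mul hg),
    ← integral_condExp hle]
  refine integral_congr_ae ?_
  have h2 : (fun z : ℝ × ℝ => z.2 * g z.1) = (fun z : ℝ × ℝ => g z.1) * Prod.snd := by
    ext z; simp [mul_comm]
  rw [h2]
  filter_upwards [h1, h.regression] with z hz hz'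
  rw [hz, Pi.mul_apply, hz', mul_comm]

end IsBoundedRegression

instance : IsProbabilityMeasure unitVolume := ⟨by simp [unitVolume]⟩

/-! ### Oracle inequality for exponential weights -/

namespace IsBoundedRegression

variable {π : Measure (ℝ × ℝ)} {f : ℝ → ℝ}

theorem integrable_sq_sub (h : IsBoundedRegression π f) {g : ℝ → ℝ} (hg : Measurable g)
    (hg01 : ∀ x, g x ∈ Icc (0 : ℝ) 1) : Integrable (fun x => (g x - f x) ^ 2) unitVolume := by
  refine Integrable.of_mem_Icc 0 1 ((hg.sub h.measurable_regression).pow_const 2).aemeasurable ?_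
  filter_upwards [h.regression_mem_Icc] with x hx
  have := hg01 x
  simp only [mem_Icc] at *
  constructor <;> nlinarith

/-- The excess loss factors as `(g - f)(g + f - 2Y)`, whose second factor lies in `[-2, 2]`. The
second moment is thus at most four times the mean, which is what permits a remainder of order `1/l`.
-/
theorem excessLoss_ae (h : IsBoundedRegression π f) {g : ℝ → ℝ} (hg01 : ∀ x, g x ∈ Icc (0 : ℝ) 1) :
    ∀ᵐ z ∂π, |(z.2 - g z.1) ^ 2 - (z.2 - f z.1) ^ 2| ≤ 1 ∧
      ((z.2 - g z.1) ^ 2 - (z.2 - f z.1) ^ 2) ^ 2 ≤ 4 * (g z.1 - f z.1) ^ 2 := by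
  filter_upwards [h.ae_fst h.regression_mem_Icc, h.bounded_response] with z hf hy
  have := hg01 z.1
  simp only [mem_Icc] at *
  refine ⟨abs_le.2 ⟨by nlinarith, by nlinarith⟩, ?_⟩
  have e : (z.2 - g z.1) ^ 2 - (z.2 - f z.1) ^ 2 =
    (g z.1 - f z.1) * (g z.1 + f z.1 - 2 * z.2) := by ring
  have h2 : (g z.1 + f z.1 - 2 * z.2) ^ 2 ≤ 4 := by nlinarith
  rw [e, mul_pow]
  nlinarith [sq_nonneg (g z.1 - f z.1)]

theorem integrable_excessLoss (h : IsBoundedRegression π f) {g : ℝ → ℝ} (hg : Measurable g)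
    (hg01 : ∀ x, g x ∈ Icc (0 : ℝ) 1) :
    Integrable (fun z : ℝ × ℝ => (z.2 - g z.1) ^ 2 - (z.2 - f z.1) ^ 2) π := by
  have := h.isProbability
  have hf := h.measurable_regression
  refine Integrable.of_bound (by fun_prop) 1 ?_
  filter_upwards [h.excessLoss_ae hg01] with z hz
  exact hz.1

/-- The excess loss is `(g - f)²` plus the cross term `2(Y - f)(f - g)`, which has mean zero. -/
theorem integral_excessLoss (h : IsBoundedRegression π f) {g : ℝ → ℝ} (hg : Measurable g)
    (hg01 : ∀ x, g x ∈ Icc (0 : ℝ) 1) :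
    ∫ z, ((z.2 - g z.1) ^ 2 - (z.2 - f z.1) ^ 2) ∂π = ∫ x, (g x - f x) ^ 2 ∂unitVolume := by
  have := h.isProbability
  have hf := h.measurable_regression
  have hfg : Integrable (fun x => f x - g x) unitVolume := by
    refine Integrable.of_mem_Icc (-1) 1 (by fun_prop) ?_
    filter_upwards [h.regression_mem_Icc] with x hx
    have := hg01 x
    simp only [mem_Icc] at *
    constructor <;> linarith
  have hffg : Integrable (fun x => f x * (f x - g x)) unitVolume := by
    refine Integrable.of_mem_Icc (-1) 1 (by fun_prop) ?_
    filter_upwards [h.regression_mem_Icc] with x hx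
    have := hg01 x
    simp only [mem_Icc] at *
    constructor <;> nlinarith
  have i1 := h.integrable_snd_mul_fst (g := fun x => f x - g x) (by fun_prop) hfg
  have i2 := h.integrable_fst (g := fun x => f x * (f x - g x)) (by fun_prop) hffg
  have i3 := h.integrable_fst (g := fun x => (g x - f x) ^ 2) (by fun_prop)
    (h.integrable_sq_sub hg hg01)
  have e : (fun z : ℝ × ℝ => (z.2 - g z.1) ^ 2 - (z.2 - f z.1) ^ 2) = fun z =>
      (g z.1 - f z.1) ^ 2 + 2 * (z.2 * (f z.1 - g z.1) - f z.1 * (f z.1 - g z.1)) := by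
    ext z; ring
  have i4 : Integrable (fun z : ℝ × ℝ =>
      2 * (z.2 * (f z.1 - g z.1) - f z.1 * (f z.1 - g z.1))) π := (i1.sub i2).const_mul 2
  rw [e, integral_add i3 i4, integral_const_mul, integral_sub i1 i2,
    h.integral_snd_mul_fst (g := fun x => f x - g x) (by fun_prop) hfg,
    h.integral_fst (g := fun x => f x * (f x - g x)) (by fun_prop),
    h.integral_fst (g := fun x => (g x - f x) ^ 2) (by fun_prop)]
  ring

theorem integrable_exp_excessLoss (h : IsBoundedRegression π f) {g : ℝ → ℝ} (hg : Measurable g)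
    (hg01 : ∀ x, g x ∈ Icc (0 : ℝ) 1) (R : ℝ) :
    Integrable (fun z : ℝ × ℝ =>
      Real.exp ((R - 2 * ((z.2 - g z.1) ^ 2 - (z.2 - f z.1) ^ 2)) / 16)) π := by
  have := h.isProbability
  have hf := h.measurable_regression
  refine Integrable.of_mem_Icc 0 (Real.exp ((R + 2) / 16)) (by fun_prop) ?_
  filter_upwards [h.excessLoss_ae hg01] with z hz
  have := abs_le.1 hz.1
  exact ⟨(Real.exp_pos _).le, Real.exp_le_exp.2 (by linarith)⟩

/-- From `e^x ≤ 1 + x + x²` at `x = -ξ/8` and `ξ² ≤ 4(g - f)²`, the mean of `exp(-ξ/8)` is at most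
`1 - R/8 + R/16 ≤ e^(-R/16)`, which cancels the factor `e^(R/16)`. -/
theorem integral_exp_excessLoss_le (h : IsBoundedRegression π f) {g : ℝ → ℝ} (hg : Measurable g)
    (hg01 : ∀ x, g x ∈ Icc (0 : ℝ) 1) :
    ∫ z, Real.exp (((∫ x, (g x - f x) ^ 2 ∂unitVolume) -
      2 * ((z.2 - g z.1) ^ 2 - (z.2 - f z.1) ^ 2)) / 16) ∂π ≤ 1 := by
  have := h.isProbability
  have hf := h.measurable_regression
  have hint := h.integrable_exp_excessLoss hg hg01 (∫ x, (g x - f x) ^ 2 ∂unitVolume)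
  have hR := h.integral_excessLoss hg hg01
  set R := ∫ x, (g x - f x) ^ 2 ∂unitVolume with hRdef
  have i3 := h.integrable_fst (g := fun x => (g x - f x) ^ 2) (by fun_prop)
    (h.integrable_sq_sub hg hg01)
  have i1 := h.integrable_excessLoss hg hg01
  have key : ∀ᵐ z ∂π, Real.exp ((R - 2 * ((z.2 - g z.1) ^ 2 - (z.2 - f z.1) ^ 2)) / 16) ≤
      Real.exp (R / 16) * ((1 - 1 / 8 * ((z.2 - g z.1) ^ 2 - (z.2 - f z.1) ^ 2)) +
        1 / 16 * (g z.1 - f z.1) ^ 2) := by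
    filter_upwards [h.excessLoss_ae hg01] with z ⟨hz1, hz2⟩
    set ξ := (z.2 - g z.1) ^ 2 - (z.2 - f z.1) ^ 2
    have e : (R - 2 * ξ) / 16 = R / 16 + (-(ξ / 8)) := by ring
    rw [e, Real.exp_add]
    have h1 : |-(ξ / 8)| ≤ 1 := by
      rw [abs_le] at hz1 ⊢; constructor <;> linarith
    have h2 := (abs_le.1 (Real.abs_exp_sub_one_sub_id_le h1)).2
    have h3 : (-(ξ / 8)) ^ 2 = ξ ^ 2 / 64 := by ring
    gcongr
    linarith
  have hi : Integrable (fun z : ℝ × ℝ => (1 - 1 / 8 * ((z.2 - g z.1) ^ 2 - (z.2 - f z.1) ^ 2)) +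
        1 / 16 * (g z.1 - f z.1) ^ 2) π :=
    ((integrable_const _).sub (i1.const_mul _)).add (i3.const_mul _)
  refine (integral_mono_ae hint (hi.const_mul _) key).trans ?_
  have e : ∫ z : ℝ × ℝ, ((1 - 1 / 8 * ((z.2 - g z.1) ^ 2 - (z.2 - f z.1) ^ 2)) +
        1 / 16 * (g z.1 - f z.1) ^ 2) ∂π = 1 - R / 16 := by
    have i4 : Integrable (fun z : ℝ × ℝ =>
        1 - 1 / 8 * ((z.2 - g z.1) ^ 2 - (z.2 - f z.1) ^ 2)) π :=
      (integrable_const _).sub (i1.const_mul _)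
    rw [integral_add i4 (i3.const_mul _), integral_sub (integrable_const _) (i1.const_mul _), integral_const_mul, integral_const_mul,
      hR, h.integral_fst (g := fun x => (g x - f x) ^ 2) (by fun_prop)]
    simp
    ring
  rw [integral_const_mul, e]
  calc Real.exp (R / 16) * (1 - R / 16) ≤ Real.exp (R / 16) * Real.exp (-(R / 16)) := by
        gcongr; linarith [Real.add_one_le_exp (-(R / 16))]
    _ = 1 := by rw [← Real.exp_add]; simp

/-- Expectation of `sum_softmax_risk_le`, with `B` the empirical risk of `f`. By independence each
exponential has mean at most one; `18 = 16 + 2` collects the exponential terms and the softmax loss.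
-/
theorem lintegral_softmax_le (h : IsBoundedRegression π f) {l : ℕ} (hl : 0 < l) (s : Finset ℕ)
    (g : ℕ → ℝ → ℝ) (hg : ∀ u, Measurable (g u)) (hg01 : ∀ u x, g u x ∈ Icc (0 : ℝ) 1)
    {u₀ : ℕ} (hu₀ : u₀ ∈ s) (A : ℕ → (Fin l → ℝ × ℝ) → ℝ)
    (hA : ∀ u D, A u D = 1 / (l : ℝ) * ∑ i, ((D i).2 - g u (D i).1) ^ 2) :
    ∫⁻ D, ∫⁻ x, ENNReal.ofReal ((∑ u ∈ s, Real.exp (-(l : ℝ) * A u D) /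
        (∑ v ∈ s, Real.exp (-(l : ℝ) * A v D)) * g u x - f x) ^ 2) ∂unitVolume
      ∂(Measure.pi fun _ : Fin l => π) ≤
    2 * ∫⁻ x, ENNReal.ofReal ((g u₀ x - f x) ^ 2) ∂unitVolume +
      ENNReal.ofReal (18 * (s.card / l)) := by
  have := h.isProbability
  have hf := h.measurable_regression
  have hl' : (0 : ℝ) < l := by exact_mod_cast hl
  set P := Measure.pi fun _ : Fin l => π
  set R : ℕ → ℝ := fun u => ∫ x, (g u x - f x) ^ 2 ∂unitVolume with hR
  set B : (Fin l → ℝ × ℝ) → ℝ := fun D => 1 / (l : ℝ) * ∑ i, ((D i).2 - f (D i).1) ^ 2 with hB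
  have hAB : ∀ u D, A u D - B D =
      1 / (l : ℝ) * ∑ i, (((D i).2 - g u (D i).1) ^ 2 - ((D i).2 - f (D i).1) ^ 2) := by
    intro u D
    rw [hA, hB, Finset.sum_sub_distrib, mul_sub]
  set E : ℕ → (Fin l → ℝ × ℝ) → ℝ := fun u D => Real.exp (l * (R u - 2 * (A u D - B D)) / 16)
    with hE
  have hEprod : ∀ u, E u = fun D => ∏ i, Real.exp ((R u -
      2 * (((D i).2 - g u (D i).1) ^ 2 - ((D i).2 - f (D i).1) ^ 2)) / 16) := by
    intro u
    ext D
    rw [← Real.exp_sum, hE]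
    simp only [hAB]
    congr 1
    rw [← Finset.sum_div, Finset.sum_sub_distrib (fun _ => R u), ← Finset.mul_sum]
    simp only [Finset.sum_const, Finset.card_univ, Fintype.card_fin, nsmul_eq_mul]
    field_simp
  have hEint : ∀ u, Integrable (E u) P := fun u => by
    rw [hEprod]
    exact Integrable.fintype_prod fun _ => h.integrable_exp_excessLoss (hg u) (hg01 u) (R u)
  have hEle : ∀ u, ∫ D, E u D ∂P ≤ 1 := fun u => by
    rw [hEprod]
    refine (integral_fintype_prod_eq_pow (μ := π) (ι := Fin l) (fun z : ℝ × ℝ => Real.exp ((R u -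
      2 * ((z.2 - g u z.1) ^ 2 - (z.2 - f z.1) ^ 2)) / 16))).trans_le ?_
    exact pow_le_one₀ (integral_nonneg fun z => (Real.exp_pos _).le)
      (h.integral_exp_excessLoss_le (hg u) (hg01 u))
  have hxi : ∀ i : Fin l, Integrable (fun D : Fin l → ℝ × ℝ =>
      ((D i).2 - g u₀ (D i).1) ^ 2 - ((D i).2 - f (D i).1) ^ 2) P := fun i =>
    (measurePreserving_eval (fun _ : Fin l => π) i).integrable_comp_of_integrable
      (h.integrable_excessLoss (hg u₀) (hg01 u₀))
  have hxi' : ∀ i : Fin l, ∫ D, (((D i).2 - g u₀ (D i).1) ^ 2 - ((D i).2 - f (D i).1) ^ 2) ∂P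
      = R u₀ := fun i => by
    rw [hR]
    simp only
    rw [← h.integral_excessLoss (hg u₀) (hg01 u₀),
      ← integral_comp_eval (μ := fun _ : Fin l => π) (i := i)
        (h.integrable_excessLoss (hg u₀) (hg01 u₀)).aestronglyMeasurable]
  have hABint : Integrable (fun D => A u₀ D - B D) P := by
    simp only [hAB]
    exact (integrable_finsetSum _ fun i _ => hxi i).const_mul _
  have hABval : ∫ D, (A u₀ D - B D) ∂P = R u₀ := by
    simp only [hAB]
    rw [integral_const_mul, integral_finsetSum _ fun i _ => hxi i]
    simp only [hxi', Finset.sum_const, Finset.card_univ, Fintype.card_fin, nsmul_eq_mul]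
    field_simp
  set H : (Fin l → ℝ × ℝ) → ℝ := fun D => ∑ u ∈ s, 16 / l * E u D + 2 * (A u₀ D - B D)
        + 2 * (s.card / l) with hH
  have hHint : Integrable H P :=
    ((integrable_finsetSum _ fun u _ => (hEint u).const_mul _).add (hABint.const_mul _)).add
      (integrable_const _)
  have hHval : ∫ D, H D ∂P ≤ 2 * R u₀ + 18 * (s.card / l) := by
    have i1 : Integrable (fun D => ∑ u ∈ s, 16 / l * E u D + 2 * (A u₀ D - B D)) P :=
      (integrable_finsetSum _ fun u _ => (hEint u).const_mul _).add (hABint.const_mul _)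
    simp only [hH]
    rw [integral_add i1 (integrable_const _), integral_add (integrable_finsetSum _
      fun u _ => (hEint u).const_mul _) (hABint.const_mul _), integral_finsetSum _
      fun u _ => (hEint u).const_mul _, integral_const_mul, hABval]
    simp only [integral_const_mul, integral_const, probReal_univ, smul_eq_mul, one_mul]
    have : ∑ u ∈ s, 16 / (l : ℝ) * ∫ D, E u D ∂P ≤ ∑ u ∈ s, 16 / (l : ℝ) * 1 :=
      Finset.sum_le_sum fun u _ => by gcongr; exact hEle u
    rw [Finset.sum_const, nsmul_eq_mul] at this
    have e : (s.card : ℝ) * (16 / l * 1) = 16 * (s.card / l) := by ring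
    linarith
  have hsq : ∀ u, Integrable (fun x => (g u x - f x) ^ 2) unitVolume := fun u =>
    h.integrable_sq_sub (hg u) (hg01 u)
  have hR0 : ∀ u, 0 ≤ R u := fun u => integral_nonneg fun x => sq_nonneg _
  -- The term `A u₀ - B` can be negative; `H` is nonnegative because it dominates a weighted sum of
  -- risks, and this is needed to pass to its Lebesgue integral in `[0,∞]`.
  have hpt : ∀ D, ∫⁻ x, ENNReal.ofReal ((∑ u ∈ s, Real.exp (-(l : ℝ) * A u D) /
        (∑ v ∈ s, Real.exp (-(l : ℝ) * A v D)) * g u x - f x) ^ 2) ∂unitVolume ≤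
      ENNReal.ofReal (H D) ∧ 0 ≤ H D := by
    intro D
    have hZpos : 0 < ∑ v ∈ s, Real.exp (-(l : ℝ) * A v D) :=
      Finset.sum_pos (fun i _ => Real.exp_pos _) ⟨u₀, hu₀⟩
    have hw0 : ∀ u, 0 ≤ Real.exp (-(l : ℝ) * A u D) / ∑ v ∈ s, Real.exp (-(l : ℝ) * A v D) :=
      fun u => by positivity
    have hle := sum_softmax_risk_le s (fun u => A u D) R (B D) hl' hu₀
    have hnn : 0 ≤ ∑ u ∈ s, Real.exp (-(l : ℝ) * A u D) /
        (∑ v ∈ s, Real.exp (-(l : ℝ) * A v D)) * R u :=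
      Finset.sum_nonneg fun u _ => mul_nonneg (hw0 u) (hR0 u)
    refine ⟨?_, hnn.trans hle⟩
    refine le_trans ?_ (ENNReal.ofReal_le_ofReal hle)
    have hint : Integrable (fun x => ∑ u ∈ s, Real.exp (-(l : ℝ) * A u D) /
        (∑ v ∈ s, Real.exp (-(l : ℝ) * A v D)) * (g u x - f x) ^ 2) unitVolume :=
      integrable_finsetSum _ fun u _ => (hsq u).const_mul _
    have hval : ∫ x, ∑ u ∈ s, Real.exp (-(l : ℝ) * A u D) /
        (∑ v ∈ s, Real.exp (-(l : ℝ) * A v D)) * (g u x - f x) ^ 2 ∂unitVolume =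
        ∑ u ∈ s, Real.exp (-(l : ℝ) * A u D) /
        (∑ v ∈ s, Real.exp (-(l : ℝ) * A v D)) * R u := by
      rw [integral_finsetSum _ fun u _ => (hsq u).const_mul _]
      simp only [integral_const_mul, hR]
    rw [← hval, ofReal_integral_eq_lintegral_ofReal hint
      (Filter.Eventually.of_forall fun x => Finset.sum_nonneg fun u _ =>
        mul_nonneg (hw0 u) (sq_nonneg _))]
    refine lintegral_mono fun x => ENNReal.ofReal_le_ofReal ?_
    refine sq_sum_mul_sub_le s _ (fun u => g u x) (f x) (fun u _ => hw0 u) ?_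
    rw [← Finset.sum_div, div_self hZpos.ne']
  refine (lintegral_mono fun D => (hpt D).1).trans ?_
  rw [← ofReal_integral_eq_lintegral_ofReal hHint
    (Filter.Eventually.of_forall fun D => (hpt D).2)]
  refine (ENNReal.ofReal_le_ofReal hHval).trans ?_
  rw [ENNReal.ofReal_add (by have := hR0 u₀; positivity) (by positivity),
    ENNReal.ofReal_mul (by norm_num), hR, ofReal_integral_eq_lintegral_ofReal (hsq u₀)
      (Filter.Eventually.of_forall fun x => sq_nonneg _)]
  simp

end IsBoundedRegression

/-! ### Stochastic error of empirical coefficients -/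

namespace IsBoundedRegression

variable {π : Measure (ℝ × ℝ)} {f : ℝ → ℝ}

theorem memLp_snd_mul_fst (h : IsBoundedRegression π f) {e : ℝ → ℝ} (he : Measurable e)
    (he2 : MemLp e 2 unitVolume) : MemLp (fun z : ℝ × ℝ => z.2 * e z.1) 2 π := by
  have h1 : MemLp (fun z : ℝ × ℝ => e z.1) 2 π := by
    rw [← h.uniform_design] at he2
    exact he2.comp_of_map measurable_fst.aemeasurable
  refine h1.of_le (by fun_prop) ?_
  filter_upwards [h.bounded_response] with z hz
  rw [norm_mul]
  refine mul_le_of_le_one_left (norm_nonneg _) ?_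
  rw [Real.norm_eq_abs, abs_le]; constructor <;> linarith [hz.1, hz.2]

theorem integral_sq_snd_mul_fst_le (h : IsBoundedRegression π f) {e : ℝ → ℝ} (he : Measurable e)
    (he2 : MemLp e 2 unitVolume) (hnorm : ∫ x, e x ^ 2 ∂unitVolume = 1) :
    ∫ z, (z.2 * e z.1) ^ 2 ∂π ≤ 1 := by
  have := h.isProbability
  rw [← hnorm, ← h.integral_fst (g := fun x => e x ^ 2) (by fun_prop)]
  refine integral_mono_ae (h.memLp_snd_mul_fst he he2).integrable_sq
    (h.integrable_fst (g := fun x => e x ^ 2) (by fun_prop) he2.integrable_sq) ?_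
  filter_upwards [h.bounded_response] with z hz
  simp only [mem_Icc] at hz
  rw [mul_pow]
  exact mul_le_of_le_one_left (sq_nonneg _) (pow_le_one₀ hz.1 hz.2)

/-- This is the variance of a mean of `m` independent copies of `Y e(X)`, whose second moment is at
most `∫ e² = 1`. -/
theorem lintegral_sq_coeff_sub_le (h : IsBoundedRegression π f) {e : ℝ → ℝ} (he : Measurable e)
    (he2 : MemLp e 2 unitVolume) (hnorm : ∫ x, e x ^ 2 ∂unitVolume = 1) {m : ℕ} (hm : 0 < m) :
    ∫⁻ D : Fin m → ℝ × ℝ, ENNReal.ofReal ((1 / (m : ℝ) * ∑ i, (D i).2 * e (D i).1 -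
      ∫ x, f x * e x ∂unitVolume) ^ 2) ∂(Measure.pi fun _ => π) ≤ ENNReal.ofReal (1 / m) := by
  have := h.isProbability
  have hm' : (0 : ℝ) < m := by exact_mod_cast hm
  set X : ℝ × ℝ → ℝ := fun z => z.2 * e z.1 with hX
  have hX2 : MemLp X 2 π := h.memLp_snd_mul_fst he he2
  have hXint : ∫ z, X z ∂π = ∫ x, f x * e x ∂unitVolume :=
    h.integral_snd_mul_fst he (he2.integrable (by norm_num))
  set P := Measure.pi fun _ : Fin m => π
  set S : (Fin m → ℝ × ℝ) → ℝ := ∑ i, fun D : Fin m → ℝ × ℝ => X (D i) with hS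
  have hXi : ∀ i : Fin m, MemLp (fun D : Fin m → ℝ × ℝ => X (D i)) 2 P := fun i =>
    hX2.comp_measurePreserving (measurePreserving_eval (fun _ : Fin m => π) i)
  have hS2 : MemLp S 2 P := memLp_finsetSum' _ fun i _ => hXi i
  have hSint : ∫ D, S D ∂P = m * ∫ x, f x * e x ∂unitVolume := by
    have : ∀ i : Fin m, ∫ D, X (D i) ∂P = ∫ x, f x * e x ∂unitVolume := fun i => by
      rw [← hXint, ← integral_comp_eval (μ := fun _ : Fin m => π) (i := i)
        hX2.aestronglyMeasurable]
    simp only [hS, Finset.sum_apply]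
    rw [integral_finsetSum _ fun i _ => (hXi i).integrable (by norm_num)]
    simp [this]
  have hvar : ProbabilityTheory.variance S P ≤ m := by
    rw [hS, ProbabilityTheory.variance_sum_pi (X := fun _ => X) (fun _ => hX2)]
    have : ProbabilityTheory.variance X π ≤ 1 :=
      (ProbabilityTheory.variance_le_expectation_sq hX2.aestronglyMeasurable).trans
        (h.integral_sq_snd_mul_fst_le he he2 hnorm)
    simpa using mul_le_mul_of_nonneg_left this hm'.le
  have key : ∀ D : Fin m → ℝ × ℝ, ENNReal.ofReal ((1 / (m : ℝ) * ∑ i, (D i).2 * e (D i).1 -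
      ∫ x, f x * e x ∂unitVolume) ^ 2) =
      ENNReal.ofReal (1 / (m : ℝ) ^ 2) * ENNReal.ofReal ((S D - ∫ D, S D ∂P) ^ 2) := by
    intro D
    rw [← ENNReal.ofReal_mul (by positivity), hSint]
    congr 1
    simp only [hS, Finset.sum_apply, hX]
    field_simp
  simp only [key]
  rw [lintegral_const_mul' _ _ ENNReal.ofReal_ne_top,
    ← ProbabilityTheory.evariance_eq_lintegral_ofReal, ← hS2.ofReal_variance_eq,
    ← ENNReal.ofReal_mul (by positivity)]
  refine ENNReal.ofReal_le_ofReal ?_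
  calc _ ≤ 1 / (m : ℝ) ^ 2 * m := by gcongr
    _ = 1 / m := by field_simp

theorem abs_integral_mul_le_one (h : IsBoundedRegression π f) {e : ℝ → ℝ}
    (he2 : MemLp e 2 unitVolume) (hnorm : ∫ x, e x ^ 2 ∂unitVolume = 1) :
    |∫ x, f x * e x ∂unitVolume| ≤ 1 := by
  rw [← Real.norm_eq_abs]
  refine (norm_integral_le_of_norm_le (g := fun x => (1 + e x ^ 2) / 2)
    (((integrable_const _).add he2.integrable_sq).div_const 2) ?_).trans ?_
  · filter_upwards [h.regression_mem_Icc] with x hx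
    simp only [mem_Icc] at hx
    rw [norm_mul, Real.norm_eq_abs, Real.norm_eq_abs, abs_of_nonneg hx.1]
    have := sq_abs (e x)
    nlinarith [abs_nonneg (e x), sq_nonneg (|e x| - 1)]
  · rw [integral_div, integral_add (integrable_const _) he2.integrable_sq, hnorm]
    simp

/-- As `|Y e(X) - c| ≤ M + 1`, the exponent stays in `[-1, 1]`, where `e^x ≤ 1 + x + x²`. The linear
term has mean zero and the variance is at most one. -/
theorem integral_exp_mul_centered_le (h : IsBoundedRegression π f) {e : ℝ → ℝ} (he : Measurable e)
    (he2 : MemLp e 2 unitVolume) (hnorm : ∫ x, e x ^ 2 ∂unitVolume = 1) {M : ℝ}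
    (hM : ∀ᵐ x ∂unitVolume, |e x| ≤ M) {a : ℝ} (ha : |a| * (M + 1) ≤ 1) :
    Integrable (fun z : ℝ × ℝ => Real.exp (a * (z.2 * e z.1 - ∫ x, f x * e x ∂unitVolume))) π ∧
    ∫ z, Real.exp (a * (z.2 * e z.1 - ∫ x, f x * e x ∂unitVolume)) ∂π ≤ Real.exp (a ^ 2) := by
  have := h.isProbability
  have hc := h.abs_integral_mul_le_one he2 hnorm
  have hXint : ∫ z, z.2 * e z.1 ∂π = ∫ x, f x * e x ∂unitVolume :=
    h.integral_snd_mul_fst he (he2.integrable (by norm_num))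
  have hX2 := h.memLp_snd_mul_fst he he2
  have hsq := h.integral_sq_snd_mul_fst_le he he2 hnorm
  set c := ∫ x, f x * e x ∂unitVolume
  have hbd : ∀ᵐ z ∂π, |a * (z.2 * e z.1 - c)| ≤ 1 := by
    filter_upwards [h.bounded_response, h.ae_fst hM] with z hz hz'
    simp only [mem_Icc] at hz
    rw [abs_mul]
    refine le_trans ?_ ha
    gcongr
    refine (abs_sub _ _).trans ?_
    rw [abs_mul, abs_of_nonneg hz.1]
    have : z.2 * |e z.1| ≤ |e z.1| := mul_le_of_le_one_left (abs_nonneg _) hz.2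
    linarith
  have hint : Integrable (fun z : ℝ × ℝ => Real.exp (a * (z.2 * e z.1 - c))) π := by
    refine Integrable.of_mem_Icc 0 (Real.exp 1) (by fun_prop) ?_
    filter_upwards [hbd] with z hz
    exact ⟨(Real.exp_pos _).le, Real.exp_le_exp.2 (le_of_abs_le hz)⟩
  refine ⟨hint, ?_⟩
  have i1 : Integrable (fun z : ℝ × ℝ => z.2 * e z.1) π := hX2.integrable (by norm_num)
  have i2 : Integrable (fun z : ℝ × ℝ => z.2 * e z.1 - c) π := i1.sub (integrable_const _)
  have i3 : Integrable (fun z : ℝ × ℝ => (z.2 * e z.1 - c) ^ 2) π :=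
    (hX2.sub (memLp_const c)).integrable_sq
  have i4 : Integrable (fun z : ℝ × ℝ => 1 + a * (z.2 * e z.1 - c)) π :=
    (integrable_const _).add (i2.const_mul _)
  have hv : ∫ z, (z.2 * e z.1 - c) ^ 2 ∂π ≤ 1 := by
    have i5 : Integrable (fun z : ℝ × ℝ => (z.2 * e z.1) ^ 2 - 2 * c * (z.2 * e z.1)) π :=
      hX2.integrable_sq.sub (i1.const_mul _)
    have : (fun z : ℝ × ℝ => (z.2 * e z.1 - c) ^ 2) = fun z =>
        ((z.2 * e z.1) ^ 2 - 2 * c * (z.2 * e z.1)) + c ^ 2 := by ext z; ring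
    rw [this, integral_add i5 (integrable_const _), integral_sub hX2.integrable_sq
      (i1.const_mul _), integral_const_mul, hXint]
    simp
    nlinarith
  calc ∫ z, Real.exp (a * (z.2 * e z.1 - c)) ∂π
      ≤ ∫ z, ((1 + a * (z.2 * e z.1 - c)) + a ^ 2 * (z.2 * e z.1 - c) ^ 2) ∂π := by
        refine integral_mono_ae hint (i4.add (i3.const_mul _)) ?_
        filter_upwards [hbd] with z hz
        have := (abs_le.1 (Real.abs_exp_sub_one_sub_id_le hz)).2
        rw [mul_pow] at this
        linarith
    _ = 1 + a ^ 2 * ∫ z, (z.2 * e z.1 - c) ^ 2 ∂π := by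
        rw [integral_add i4 (i3.const_mul _), integral_add (integrable_const _) (i2.const_mul _),
          integral_const_mul, integral_const_mul, integral_sub i1 (integrable_const _), hXint]
        simp
    _ ≤ 1 + a ^ 2 * 1 := by gcongr
    _ ≤ _ := by linarith [Real.add_one_le_exp (a ^ 2)]

theorem integral_exp_mul_coeff_sub_le (h : IsBoundedRegression π f) {e : ℝ → ℝ} (he : Measurable e)
    (he2 : MemLp e 2 unitVolume) (hnorm : ∫ x, e x ^ 2 ∂unitVolume = 1) {M : ℝ}
    (hM : ∀ᵐ x ∂unitVolume, |e x| ≤ M) {m : ℕ} (hm : 0 < m) {a : ℝ} (ha : |a| * (M + 1) ≤ m) :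
    Integrable (fun D : Fin m → ℝ × ℝ => Real.exp (a * (1 / (m : ℝ) * ∑ i, (D i).2 * e (D i).1 -
      ∫ x, f x * e x ∂unitVolume))) (Measure.pi fun _ => π) ∧
    ∫ D : Fin m → ℝ × ℝ, Real.exp (a * (1 / (m : ℝ) * ∑ i, (D i).2 * e (D i).1 -
      ∫ x, f x * e x ∂unitVolume)) ∂(Measure.pi fun _ => π) ≤ Real.exp (a ^ 2 / m) := by
  have := h.isProbability
  have hm' : (0 : ℝ) < m := by exact_mod_cast hm
  have ha' : |a / m| * (M + 1) ≤ 1 := by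
    rw [abs_div, abs_of_pos hm', div_mul_eq_mul_div, div_le_one hm']
    exact ha
  obtain ⟨h1, h2⟩ := h.integral_exp_mul_centered_le he he2 hnorm hM ha'
  set c := ∫ x, f x * e x ∂unitVolume
  have e1 : (fun D : Fin m → ℝ × ℝ => Real.exp (a * (1 / (m : ℝ) * ∑ i, (D i).2 * e (D i).1 - c)))
      = fun D => ∏ i, Real.exp (a / m * ((D i).2 * e (D i).1 - c)) := by
    ext D
    rw [← Real.exp_sum, ← Finset.mul_sum, Finset.sum_sub_distrib]
    simp only [Finset.sum_const, Finset.card_univ, Fintype.card_fin, nsmul_eq_mul]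
    congr 1
    field_simp
  rw [e1]
  refine ⟨Integrable.fintype_prod fun _ => h1, ?_⟩
  refine (integral_fintype_prod_eq_pow (μ := π) (ι := Fin m)
    (fun z : ℝ × ℝ => Real.exp (a / m * (z.2 * e z.1 - c)))).trans_le ?_
  refine (pow_le_pow_left₀ (integral_nonneg fun z => (Real.exp_pos _).le) h2 _).trans_eq ?_
  rw [← Real.exp_nat_mul, Fintype.card_fin]
  congr 1
  field_simp

/-- One eighth of the exponent `lam |z|` pays for `z²` through `x²/2 ≤ e^x`; the other seven eighths
become `exp(-7/8 lam t)` on the event `|z| ≥ t`. -/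
theorem _root_.ite_sq_le_exp {lam t : ℝ} (hlam : 0 < lam) (z : ℝ) :
    (if t ≤ |z| then |z| ^ 2 else 0) ≤
      128 / lam ^ 2 * Real.exp (-(7 / 8 * lam * t)) *
        (Real.exp (lam * z) + Real.exp (-lam * z)) := by
  split_ifs with h
  · have h1 : |z| ^ 2 ≤ 128 / lam ^ 2 * Real.exp (lam * |z| / 8) := by
      have := Real.quadratic_le_exp_of_nonneg (x := lam * |z| / 8) (by positivity)
      rw [div_mul_eq_mul_div, le_div_iff₀ (by positivity)]
      have h0 : 0 ≤ lam * |z| / 8 := by positivity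
      nlinarith
    have h2 : Real.exp (lam * |z|) ≤ Real.exp (lam * z) + Real.exp (-lam * z) := by
      rcases abs_cases z with ⟨hz, _⟩ | ⟨hz, _⟩
      · rw [hz]; linarith [Real.exp_pos (-lam * z)]
      · rw [hz, show lam * -z = -lam * z by ring]; linarith [Real.exp_pos (lam * z)]
    calc |z| ^ 2 ≤ 128 / lam ^ 2 * Real.exp (lam * |z| / 8) := h1
      _ ≤ 128 / lam ^ 2 * (Real.exp (-(7 / 8 * lam * t)) * Real.exp (lam * |z|)) := by
        rw [← Real.exp_add]
        gcongr
        nlinarith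
      _ ≤ 128 / lam ^ 2 * (Real.exp (-(7 / 8 * lam * t)) *
          (Real.exp (lam * z) + Real.exp (-lam * z))) := by gcongr
      _ = _ := by ring
  · positivity

theorem lintegral_ite_sq_coeff_sub_le (h : IsBoundedRegression π f) {e : ℝ → ℝ} (he : Measurable e)
    (he2 : MemLp e 2 unitVolume) (hnorm : ∫ x, e x ^ 2 ∂unitVolume = 1) {M : ℝ}
    (hM : ∀ᵐ x ∂unitVolume, |e x| ≤ M) {m : ℕ} (hm : 0 < m) {lam : ℝ} (hlam : 0 < lam)
    (hlamM : lam * (M + 1) ≤ m) (t : ℝ) :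
    ∫⁻ D : Fin m → ℝ × ℝ, ENNReal.ofReal (if t ≤ |1 / (m : ℝ) * ∑ i, (D i).2 * e (D i).1 -
      ∫ x, f x * e x ∂unitVolume| then |1 / (m : ℝ) * ∑ i, (D i).2 * e (D i).1 -
      ∫ x, f x * e x ∂unitVolume| ^ 2 else 0) ∂(Measure.pi fun _ => π) ≤
    ENNReal.ofReal (256 / lam ^ 2 * Real.exp (lam ^ 2 / m - 7 / 8 * lam * t)) := by
  obtain ⟨i1, j1⟩ := h.integral_exp_mul_coeff_sub_le he he2 hnorm hM hm (a := lam)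
    (by rwa [abs_of_pos hlam])
  obtain ⟨i2, j2⟩ := h.integral_exp_mul_coeff_sub_le he he2 hnorm hM hm (a := -lam)
    (by rwa [abs_neg, abs_of_pos hlam])
  have i3 : Integrable (fun D : Fin m → ℝ × ℝ => Real.exp (lam * (1 / (m : ℝ) *
      ∑ i, (D i).2 * e (D i).1 - ∫ x, f x * e x ∂unitVolume)) + Real.exp (-lam * (1 / (m : ℝ) *
      ∑ i, (D i).2 * e (D i).1 - ∫ x, f x * e x ∂unitVolume))) (Measure.pi fun _ => π) := i1.add i2
  refine (lintegral_mono fun D => ENNReal.ofReal_le_ofReal (ite_sq_le_exp hlam _)).trans ?_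
  rw [← ofReal_integral_eq_lintegral_ofReal (i3.const_mul _)
    (Filter.Eventually.of_forall fun D => by positivity),
    integral_const_mul]
  refine ENNReal.ofReal_le_ofReal ?_
  rw [integral_add i1 i2]
  rw [neg_sq] at j2
  calc _ ≤ 128 / lam ^ 2 * Real.exp (-(7 / 8 * lam * t)) *
        (Real.exp (lam ^ 2 / m) + Real.exp (lam ^ 2 / m)) := by gcongr
    _ = 256 / lam ^ 2 * (Real.exp (lam ^ 2 / m) * Real.exp (-(7 / 8 * lam * t))) := by ring
    _ = _ := by rw [← Real.exp_add]; rfl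

end IsBoundedRegression

/-! ### Periodized wavelets -/

theorem measurable_perWavelet {g : ℝ → ℝ} (hg : Measurable g) (j k : ℕ) :
    Measurable (perWavelet g j k) := by
  unfold perWavelet dilate
  exact Measurable.tsum fun l => by fun_prop

theorem ae_comp_affine {p : ℝ → Prop} (hp : ∀ᵐ x ∂volume, p x) {a : ℝ} (ha : a ≠ 0) (b : ℝ) :
    ∀ᵐ x ∂volume, p (a * x + b) := by
  have h1 : Measure.QuasiMeasurePreserving (fun x : ℝ => a * x) volume volume := by
    refine ⟨by fun_prop, ?_⟩
    rw [Real.map_volume_mul_left ha]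
    exact Measure.smul_absolutelyContinuous
  exact ((measurePreserving_add_right volume b).quasiMeasurePreserving.comp h1).ae hp

theorem ae_abs_le_supNorm {g : ℝ → ℝ} (hg : MemLp g ∞ volume) : ∀ᵐ x ∂volume, |g x| ≤ supNorm g := by
  filter_upwards [ae_le_eLpNormEssSup (f := g) (μ := volume)] with x hx
  rw [← eLpNorm_exponent_top] at hx
  have := ENNReal.toReal_mono hg.2.ne hx
  simpa [supNorm] using this

/-- If the support of `g` is shorter than `2 ^ j`, then the translates in the periodization of
`g_{j,k}` do not overlap. -/
theorem abs_perWavelet_le_of_support {g : ℝ → ℝ} {R : ℝ} (hR : ∀ x, R ≤ ‖x‖ → g x = 0) {j : ℕ}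
    (hj : 2 * R ≤ 2 ^ j) (k : ℕ) {x B : ℝ} (hB : 0 ≤ B)
    (hx : ∀ l : ℤ, |g (2 ^ j * (x - l) - k)| ≤ B) :
    |perWavelet g j k x| ≤ (2 : ℝ) ^ ((j : ℝ) / 2) * B := by
  unfold perWavelet
  by_cases h : ∃ l : ℤ, g (2 ^ j * (x - l) - k) ≠ 0
  · obtain ⟨l, hl⟩ := h
    rw [tsum_eq_single l]
    · unfold dilate
      rw [abs_mul, abs_of_pos (by positivity)]
      gcongr
      exact hx l
    · intro l' hl'
      unfold dilate
      have h1 : ‖2 ^ j * (x - (l : ℝ)) - k‖ < R := by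
        by_contra hc
        exact hl (hR _ (not_lt.1 hc))
      rw [hR, mul_zero]
      -- Two nonvanishing translates would give two points of `(-R, R)` at distance at least `2^j ≥
      -- 2R`.
      by_contra hc
      rw [not_le, Real.norm_eq_abs, abs_lt] at hc
      rw [Real.norm_eq_abs, abs_lt] at h1
      have h2 : (1 : ℝ) ≤ |(l : ℝ) - l'| := by
        have : 1 ≤ |l - l'| := Int.one_le_abs (sub_ne_zero.2 hl'.symm)
        exact_mod_cast this
      have hp : (0 : ℝ) < 2 ^ j := by positivity
      rcases le_abs.1 h2 with h3 | h3
      · have := mul_le_mul_of_nonneg_left h3 hp.le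
        nlinarith [hc.1, hc.2, h1.1, h1.2]
      · have := mul_le_mul_of_nonneg_left h3 hp.le
        nlinarith [hc.1, hc.2, h1.1, h1.2]
  · push Not at h
    have : ∀ l : ℤ, dilate g j k (x - l) = 0 := fun l => by simp [dilate, h l]
    simp only [this, tsum_zero, abs_zero]
    positivity

/-- Only an essential bound on `g` is available, so it is transported along countably many affine
maps, which preserve null sets. `J` is a level from which the translates no longer overlap. -/
theorem exists_abs_perWavelet_le {g : ℝ → ℝ} (hc : HasCompactSupport g) (hb : MemLp g ∞ volume) :
    ∃ J : ℕ, ∀ j, J ≤ j → ∀ k, ∀ᵐ x ∂unitVolume,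
      |perWavelet g j k x| ≤ (2 : ℝ) ^ ((j : ℝ) / 2) * supNorm g := by
  obtain ⟨R, hR0, hR⟩ := hc.exists_pos_le_norm
  obtain ⟨J, hJ⟩ := pow_unbounded_of_one_lt (2 * R) (one_lt_two (α := ℝ))
  refine ⟨J, fun j hj k => ae_restrict_of_ae ?_⟩
  have h1 : ∀ᵐ x ∂(volume : Measure ℝ), ∀ l : ℤ, |g (2 ^ j * (x - l) - k)| ≤ supNorm g := by
    rw [ae_all_iff]
    intro l
    filter_upwards [ae_comp_affine (ae_abs_le_supNorm hb) (a := 2 ^ j) (by positivity)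
      (-(2 ^ j * l) - k)] with x hx
    convert hx using 3
    ring
  filter_upwards [h1] with x hx
  refine abs_perWavelet_le_of_support hR ?_ k ENNReal.toReal_nonneg hx
  exact hJ.le.trans (pow_le_pow_right₀ one_le_two hj)

/-! ### Parseval's identity -/

/-- Parseval's identity for the difference between a finite expansion and `f`; off `S` the
coefficient is estimated by zero. -/
theorem lintegral_sq_sum_sub_eq_tsum {ι : Type*} [DecidableEq ι] {μ : Measure ℝ}
    (b : HilbertBasis ι ℝ (Lp ℝ 2 μ)) (e : ι → ℝ → ℝ) (hb : ∀ i, (b i : ℝ → ℝ) =ᵐ[μ] e i)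
    {f : ℝ → ℝ} (hf : MemLp f 2 μ) (S : Finset ι) (a : ι → ℝ) :
    ∫⁻ x, ENNReal.ofReal ((∑ i ∈ S, a i * e i x - f x) ^ 2) ∂μ =
      ∑' i, ENNReal.ofReal (((if i ∈ S then a i else 0) - ∫ x, f x * e i x ∂μ) ^ 2) := by
  set G : Lp ℝ 2 μ := ∑ i ∈ S, a i • b i - hf.toLp f with hG
  have hGae : (G : ℝ → ℝ) =ᵐ[μ] fun x => ∑ i ∈ S, a i * e i x - f x := by
    have h1 : ((∑ i ∈ S, a i • b i : Lp ℝ 2 μ) : ℝ → ℝ) =ᵐ[μ] fun x => ∑ i ∈ S, a i * e i x := by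
      refine (Lp.coeFn_finsetSum _ _).trans ?_
      have h2 : ∀ i ∈ S, ((a i • b i : Lp ℝ 2 μ) : ℝ → ℝ) =ᵐ[μ] fun x => a i * e i x := by
        intro i _
        filter_upwards [Lp.coeFn_smul (a i) (b i), hb i] with x hx hx'
        rw [hx, Pi.smul_apply, hx', smul_eq_mul]
      have h3 : ∀ᵐ x ∂μ, ∀ i ∈ S, ((a i • b i : Lp ℝ 2 μ) : ℝ → ℝ) x = a i * e i x :=
        (ae_ball_iff S.countable_toSet).2 h2
      filter_upwards [h3] with x hx
      rw [Finset.sum_apply]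
      exact Finset.sum_congr rfl hx
    filter_upwards [Lp.coeFn_sub (∑ i ∈ S, a i • b i) (hf.toLp f), h1, hf.coeFn_toLp]
      with x hx h1 h2
    rw [hG, hx, Pi.sub_apply, h1, h2]
  have hinner : ∀ i, inner ℝ (b i) G = (if i ∈ S then a i else 0) - ∫ x, f x * e i x ∂μ := by
    intro i
    rw [hG, inner_sub_right, inner_sum]
    congr 1
    · simp only [inner_smul_right, orthonormal_iff_ite.1 b.orthonormal]
      simp
    · rw [L2.inner_def]
      refine integral_congr_ae ?_
      filter_upwards [hb i, hf.coeFn_toLp] with x h1 h2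
      rw [h1, h2]
      simp
  have hsum := b.hasSum_inner_mul_inner G G
  have e1 : ∀ i, inner ℝ G (b i) * inner ℝ (b i) G =
      ((if i ∈ S then a i else 0) - ∫ x, f x * e i x ∂μ) ^ 2 := fun i => by
    rw [real_inner_comm, hinner, sq]
  simp only [e1] at hsum
  rw [← ENNReal.ofReal_tsum_of_nonneg (fun i => sq_nonneg _) hsum.summable, hsum.tsum_eq,
    L2.inner_def, ofReal_integral_eq_lintegral_ofReal (L2.integrable_inner G G)
      (Filter.Eventually.of_forall fun x => by
        simp only [RCLike.inner_apply, conj_trivial, Pi.zero_apply]; exact mul_self_nonneg _)]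
  refine lintegral_congr_ae ?_
  filter_upwards [hGae] with x hx
  rw [hx]
  simp only [RCLike.inner_apply, conj_trivial, sq]

namespace IsPeriodizedWaveletBasis

variable {φ ψ : ℝ → ℝ} {τ : ℕ}

theorem measurable_waveletFun (h : IsPeriodizedWaveletBasis φ ψ τ) (i : WaveletIndex τ) :
    Measurable (waveletFun φ ψ τ i) := by
  rcases i with k | ⟨i, k⟩
  · exact measurable_perWavelet h.measurable_father _ _
  · exact measurable_perWavelet h.measurable_mother _ _

theorem memLp_waveletFun (h : IsPeriodizedWaveletBasis φ ψ τ) (i : WaveletIndex τ) :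
    MemLp (waveletFun φ ψ τ i) 2 unitVolume := by
  obtain ⟨b, hb⟩ := h.orthonormal_basis
  exact (memLp_congr_ae (hb i)).1 (Lp.memLp _)

theorem integral_sq_waveletFun (h : IsPeriodizedWaveletBasis φ ψ τ) (i : WaveletIndex τ) :
    ∫ x, waveletFun φ ψ τ i x ^ 2 ∂unitVolume = 1 := by
  obtain ⟨b, hb⟩ := h.orthonormal_basis
  have h1 : inner ℝ (b i) (b i) = (1 : ℝ) := by
    rw [real_inner_self_eq_norm_sq, b.orthonormal.1 i, one_pow]
  rw [← h1, L2.inner_def]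
  refine integral_congr_ae ?_
  filter_upwards [hb i] with x hx
  rw [hx]
  simp [sq]

theorem lintegral_sq_thresholdEstimator_sub (h : IsPeriodizedWaveletBasis φ ψ τ) (Υ : ℝ → ℝ → ℝ)
    (j₁ : ℕ) (lam : ℕ → ℝ) {m : ℕ} (D : Fin m → ℝ × ℝ) {f : ℝ → ℝ} (hf : MemLp f 2 unitVolume) :
    ∫⁻ x, ENNReal.ofReal ((thresholdEstimator φ ψ τ Υ j₁ lam D x - f x) ^ 2) ∂unitVolume =
      ∑ k : Fin (2 ^ τ), ENNReal.ofReal ((coeffEstimate φ D τ k - waveletCoeff φ f τ k) ^ 2) +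
      ∑' i : ℕ, ∑ k : Fin (2 ^ (τ + i)), ENNReal.ofReal
        (((if τ + i ≤ j₁ then Υ (lam (τ + i)) (coeffEstimate ψ D (τ + i) k) else 0)
          - waveletCoeff ψ f (τ + i) k) ^ 2) := by
  classical
  obtain ⟨b, hb⟩ := h.orthonormal_basis
  set S : Finset (WaveletIndex τ) := Finset.disjSum Finset.univ
    ((Finset.range (j₁ + 1 - τ)).sigma fun _ => Finset.univ) with hS
  set a : WaveletIndex τ → ℝ := fun i => match i with
    | Sum.inl k => coeffEstimate φ D τ k
    | Sum.inr ⟨i, k⟩ => Υ (lam (τ + i)) (coeffEstimate ψ D (τ + i) k) with ha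
  have h1 : ∀ x, thresholdEstimator φ ψ τ Υ j₁ lam D x = ∑ i ∈ S, a i * waveletFun φ ψ τ i x := by
    intro x
    rw [hS, Finset.sum_disjSum, Finset.sum_sigma, thresholdEstimator]
    congr 1
    · rw [Finset.sum_range]
      rfl
    · rw [← Finset.Ico_add_one_right_eq_Icc, Finset.sum_Ico_eq_sum_range]
      refine Finset.sum_congr rfl fun i _ => ?_
      rw [Finset.sum_range]
      rfl
  simp only [h1]
  rw [lintegral_sq_sum_sub_eq_tsum b _ hb hf, Summable.tsum_sum ENNReal.summable ENNReal.summable,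
    tsum_fintype, ENNReal.tsum_sigma' (fun p : (Σ i : ℕ, Fin (2 ^ (τ + i))) =>
      ENNReal.ofReal (((if Sum.inr p ∈ S then a (Sum.inr p) else 0) -
        ∫ x, f x * waveletFun φ ψ τ (Sum.inr p) x ∂unitVolume) ^ 2))]
  congr 1
  · refine Finset.sum_congr rfl fun k _ => ?_
    rw [if_pos (by simp [hS])]
    rfl
  · refine tsum_congr fun i => ?_
    rw [tsum_fintype]
    refine Finset.sum_congr rfl fun k _ => ?_
    have : (Sum.inr ⟨i, k⟩ ∈ S) ↔ τ + i ≤ j₁ := by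
      simp only [hS, Finset.inr_mem_disjSum, Finset.mem_sigma, Finset.mem_range, Finset.mem_univ,
        and_true]
      omega
    simp only [this]
    rfl

end IsPeriodizedWaveletBasis

/-! ### Stochastic error of thresholded coefficients -/

/-- For `m ≥ 8` one has `log m ≥ 2`, so `2^j ≤ m` and `j ≤ log m / log 2`. The product is at most
`2m / log 2`, and `2.89 = 1.7²` is a convenient value above `2 / log 2`. -/
theorem mul_two_pow_le_of_lt_div_log {m j : ℕ} (hm : 8 ≤ m)
    (hj : (2 : ℝ) ^ j < 2 * ((m : ℝ) / Real.log m)) : (j : ℝ) * 2 ^ j ≤ 2.89 * m := by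
  have hm' : (8 : ℝ) ≤ m := by exact_mod_cast hm
  have hlog2 := Real.log_two_gt_d9
  have hlog : 2 ≤ Real.log m := by
    calc (2 : ℝ) ≤ Real.log (2 ^ 3) := by rw [Real.log_pow]; push_cast; linarith
      _ ≤ Real.log m := Real.log_le_log (by norm_num) (by linarith)
  have h1 : (2 : ℝ) ^ j ≤ m := by
    refine hj.le.trans ?_
    rw [← mul_div_assoc, div_le_iff₀ (by linarith)]
    nlinarith
  have h2 : j * Real.log 2 ≤ Real.log m := by
    rw [← Real.log_pow]
    exact Real.log_le_log (by positivity) h1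
  have h3 : (j : ℝ) ≤ Real.log m / Real.log 2 := by rwa [le_div_iff₀ (by linarith)]
  calc (j : ℝ) * 2 ^ j ≤ Real.log m / Real.log 2 * (2 * ((m : ℝ) / Real.log m)) := by
        gcongr
    _ = 2 * m / Real.log 2 := by field_simp
    _ ≤ 2.89 * m := by rw [div_le_iff₀ (by linarith)]; nlinarith

/-- The condition on `ρ` is used here. It gives `ρ² ≥ 4 log 2 (8 + 1.885 ρ r)`, and what remains is
a quadratic inequality in `ρ r`. The factor `5/4` exceeds one so that the noise bound beats the
number of coefficients per level. -/
theorem bernstein_exponent_ge {ρ r : ℝ} (hρ : 0 < ρ) (hr : 0 ≤ r)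
    (h : 4 * Real.log 2 ≤ ρ ^ 2 / (8 + 8 * ρ / (3 * Real.sqrt 2) * r)) :
    5 / 4 * Real.log 2 * (2 + 0.85 * ρ * r) ^ 2 ≤
      ρ ^ 2 / 4 * (7 / 8 * (2 + 0.85 * ρ * r) - 1) := by
  have hs0 : 0 < Real.sqrt 2 := by positivity
  have hs : Real.sqrt 2 ≤ 1.4143 := Real.sqrt_le_iff.2 (by norm_num)
  have hlog2 := Real.log_two_gt_d9
  have hx : 0 ≤ ρ * r := by positivity
  have h1 : 8 + 1.885 * (ρ * r) ≤ 8 + 8 * ρ / (3 * Real.sqrt 2) * r := by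
    have : 1.885 ≤ 8 / (3 * Real.sqrt 2) := by
      rw [le_div_iff₀ (by positivity)]; nlinarith
    have e : 8 * ρ / (3 * Real.sqrt 2) * r = 8 / (3 * Real.sqrt 2) * (ρ * r) := by ring
    rw [e]
    nlinarith
  rw [le_div_iff₀ (by nlinarith)] at h
  have h2 : 4 * Real.log 2 * (8 + 1.885 * (ρ * r)) ≤ ρ ^ 2 := by nlinarith
  have e : (0.85 : ℝ) * ρ * r = 0.85 * (ρ * r) := by ring
  rw [e]
  set x := ρ * r
  have h3 : (0 : ℝ) ≤ 7 / 8 * (2 + 0.85 * x) - 1 := by nlinarith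
  have h4 := mul_le_mul_of_nonneg_right h2 h3
  have h5 : 5 / 4 * (2 + 0.85 * x) ^ 2 ≤ (8 + 1.885 * x) * (7 / 8 * (2 + 0.85 * x) - 1) := by
    nlinarith [sq_nonneg x]
  have h6 := mul_le_mul_of_nonneg_left h5 (show 0 ≤ Real.log 2 by linarith)
  linarith

namespace IsPeriodizedWaveletBasis

variable {φ ψ : ℝ → ℝ} {τ : ℕ} {π : Measure (ℝ × ℝ)} {f : ℝ → ℝ}

theorem lintegral_sq_father_le (h : IsPeriodizedWaveletBasis φ ψ τ) (hπ : IsBoundedRegression π f)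
    {m : ℕ} (hm : 0 < m) (k : Fin (2 ^ τ)) :
    ∫⁻ D : Fin m → ℝ × ℝ, ENNReal.ofReal ((coeffEstimate φ D τ k - waveletCoeff φ f τ k) ^ 2)
      ∂(Measure.pi fun _ => π) ≤ ENNReal.ofReal (1 / m) :=
  hπ.lintegral_sq_coeff_sub_le (h.measurable_waveletFun (Sum.inl k))
    (h.memLp_waveletFun (Sum.inl k)) (h.integral_sq_waveletFun (Sum.inl k)) hm

theorem lintegral_sq_mother_le (h : IsPeriodizedWaveletBasis φ ψ τ) (hπ : IsBoundedRegression π f)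
    {m : ℕ} (hm : 0 < m) (i : ℕ) (k : Fin (2 ^ (τ + i))) :
    ∫⁻ D : Fin m → ℝ × ℝ, ENNReal.ofReal
      ((coeffEstimate ψ D (τ + i) k - waveletCoeff ψ f (τ + i) k) ^ 2)
      ∂(Measure.pi fun _ => π) ≤ ENNReal.ofReal (1 / m) :=
  hπ.lintegral_sq_coeff_sub_le (h.measurable_waveletFun (Sum.inr ⟨i, k⟩))
    (h.memLp_waveletFun (Sum.inr ⟨i, k⟩)) (h.integral_sq_waveletFun (Sum.inr ⟨i, k⟩)) hm

/-- The exponential tail bound at parameter `m t / G`, where `t` is half the threshold. Since `m t²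
= ρ² (j - u) / 4`, the exponent is linear in `j - u`. -/
theorem lintegral_ite_sq_mother_le (h : IsPeriodizedWaveletBasis φ ψ τ)
    (hπ : IsBoundedRegression π f) {ρ : ℝ} (hρ : 0 < ρ)
    (hρψ : 4 * Real.log 2 ≤ ρ ^ 2 / (8 + 8 * ρ / (3 * Real.sqrt 2) * (supNorm ψ + 1)))
    {m j₁ u : ℕ} (hm : 8 ≤ m) (hj₁ : (2 : ℝ) ^ j₁ < 2 * ((m : ℝ) / Real.log m))
    {i : ℕ} (hi : τ + i ≤ j₁) (hu : u < τ + i) (k : Fin (2 ^ (τ + i)))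
    (hbd : ∀ᵐ x ∂unitVolume,
      |perWavelet ψ (τ + i) k x| ≤ (2 : ℝ) ^ (((τ + i : ℕ) : ℝ) / 2) * supNorm ψ) :
    ∫⁻ D : Fin m → ℝ × ℝ, ENNReal.ofReal
      (if levelThreshold ρ m u (τ + i) / 2 ≤
          |coeffEstimate ψ D (τ + i) k - waveletCoeff ψ f (τ + i) k| then
        |coeffEstimate ψ D (τ + i) k - waveletCoeff ψ f (τ + i) k| ^ 2 else 0)
      ∂(Measure.pi fun _ => π) ≤
    ENNReal.ofReal (1024 * (2 + 0.85 * ρ * (supNorm ψ + 1)) ^ 2 / ρ ^ 2 / m *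
      (2 : ℝ) ^ (-(5 / 4) * ((τ + i - u : ℕ) : ℝ))) := by
  have hψ0 : 0 ≤ supNorm ψ := ENNReal.toReal_nonneg
  have hm0 : 0 < m := by omega
  have hm' : (0 : ℝ) < m := by exact_mod_cast hm0
  have key := fun (lam t : ℝ) (hlam : 0 < lam) (hlamM) =>
    hπ.lintegral_ite_sq_coeff_sub_le (h.measurable_waveletFun (Sum.inr ⟨i, k⟩))
    (h.memLp_waveletFun (Sum.inr ⟨i, k⟩)) (h.integral_sq_waveletFun (Sum.inr ⟨i, k⟩)) hbd hm0
    hlam hlamM t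
  set j := τ + i with hj
  set d := j - u with hd
  have hd1 : 1 ≤ d := by omega
  have hd' : (1 : ℝ) ≤ d := by exact_mod_cast hd1
  set r := supNorm ψ + 1 with hr
  have hr0 : 0 < r := by positivity
  -- The term `0.85 ρ r` dominates `t (M + 1)`, as the Bernstein range requires; it is half of `1.7
  -- ρ r`, with `1.7` bounding `√(d 2^j / m)`. The summand `2` keeps `7/8 G - 1` positive.
  set G := 2 + 0.85 * ρ * r with hG
  have hG0 : 0 < G := by positivity
  set t := levelThreshold ρ m u j / 2 with ht
  have htval : t = ρ * Real.sqrt (d / m) / 2 := rfl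
  have ht0 : 0 < t := by rw [htval]; positivity
  have hmt : m * t ^ 2 = ρ ^ 2 * d / 4 := by
    rw [htval, div_pow, mul_pow, Real.sq_sqrt (by positivity)]
    field_simp
    norm_num
  have hjm : (d : ℝ) * 2 ^ j ≤ 2.89 * m := by
    refine le_trans ?_ (mul_two_pow_le_of_lt_div_log hm hj₁)
    have : d ≤ j₁ := by omega
    gcongr
    exact one_le_two
  have hMt : t * ((2 : ℝ) ^ ((j : ℝ) / 2) * supNorm ψ + 1) ≤ G := by
    have h1 : (1 : ℝ) ≤ (2 : ℝ) ^ ((j : ℝ) / 2) := Real.one_le_rpow one_le_two (by positivity)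
    have h2 : (2 : ℝ) ^ ((j : ℝ) / 2) * supNorm ψ + 1 ≤ (2 : ℝ) ^ ((j : ℝ) / 2) * r := by
      rw [hr]; linarith
    have h3 : Real.sqrt (d / m) * (2 : ℝ) ^ ((j : ℝ) / 2) ≤ 1.7 := by
      have e : (2 : ℝ) ^ ((j : ℝ) / 2) = Real.sqrt (2 ^ j) := by
        rw [Real.sqrt_eq_rpow, ← Real.rpow_natCast, ← Real.rpow_mul (by norm_num)]
        congr 1
        ring
      rw [e, ← Real.sqrt_mul (by positivity)]
      refine Real.sqrt_le_iff.2 ⟨by norm_num, ?_⟩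
      rw [div_mul_eq_mul_div, div_le_iff₀ hm']
      norm_num at hjm ⊢
      exact hjm
    calc t * ((2 : ℝ) ^ ((j : ℝ) / 2) * supNorm ψ + 1) ≤ t * ((2 : ℝ) ^ ((j : ℝ) / 2) * r) := by
          gcongr
      _ = ρ * r / 2 * (Real.sqrt (d / m) * (2 : ℝ) ^ ((j : ℝ) / 2)) := by rw [htval]; ring
      _ ≤ ρ * r / 2 * 1.7 := by gcongr
      _ ≤ G := by rw [hG]; linarith
  have hlam : 0 < m * t / G := by positivity
  refine (key (m * t / G) t hlam ?_).trans ?_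
  · rw [div_mul_eq_mul_div, div_le_iff₀ hG0, mul_assoc]
    gcongr
  · refine ENNReal.ofReal_le_ofReal ?_
    have hexp := bernstein_exponent_ge hρ hr0.le hρψ
    rw [← hG] at hexp
    have e1 : (m * t / G) ^ 2 / m - 7 / 8 * (m * t / G) * t =
        -(d * (ρ ^ 2 / 4 * (7 / 8 * G - 1)) / G ^ 2) := by
      have : (m * t / G) ^ 2 / m - 7 / 8 * (m * t / G) * t =
        -((m * t ^ 2) * (7 / 8 * G - 1) / G ^ 2) := by
        field_simp
        ring
      rw [this, hmt]
      ring
    have e2 : (m * t / G) ^ 2 = m * (ρ ^ 2 * d / 4) / G ^ 2 := by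
      rw [← hmt]; field_simp
    rw [e1, e2]
    gcongr ?_ * ?_
    · rw [div_div_eq_mul_div, div_div, div_le_div_iff₀ (by positivity) (by positivity)]
      have : 0 < G ^ 2 * (ρ ^ 2 * m) := by positivity
      nlinarith
    · rw [Real.rpow_def_of_pos (by norm_num)]
      refine Real.exp_le_exp.2 ?_
      have h1 : 5 / 4 * Real.log 2 * d ≤ d * (ρ ^ 2 / 4 * (7 / 8 * G - 1)) / G ^ 2 := by
        rw [le_div_iff₀ (by positivity)]
        nlinarith
      linarith

end IsPeriodizedWaveletBasis

/-! ### Wavelet coefficients of functions in a Besov ball -/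

theorem le_seqNorm {ι : Type*} {p : ℝ≥0∞} (hp : 1 ≤ p) (a : ι → ℝ≥0∞) (i : ι) :
    a i ≤ seqNorm p a := by
  unfold seqNorm
  split_ifs with h
  · exact le_iSup a i
  · have hp0 : 0 < p.toReal := ENNReal.toReal_pos (zero_lt_one.trans_le hp).ne' h
    calc a i = (a i ^ p.toReal) ^ (p.toReal⁻¹) := by
          rw [← ENNReal.rpow_mul, mul_inv_cancel₀ hp0.ne', ENNReal.rpow_one]
      _ ≤ _ := by
          gcongr
          exact ENNReal.le_tsum i

theorem abs_le_of_seqNorm_le {ι : Type*} {p : ℝ≥0∞} (hp : 1 ≤ p) {a : ι → ℝ} {A : ℝ} (hA : 0 ≤ A)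
    (h : seqNorm p (fun i => ‖a i‖ₑ) ≤ ENNReal.ofReal A) (i : ι) : |a i| ≤ A := by
  have := (le_seqNorm hp (fun i => ‖a i‖ₑ) i).trans h
  simp only [Real.enorm_eq_ofReal_abs] at this
  rwa [ENNReal.ofReal_le_ofReal_iff hA] at this

theorem sum_rpow_le_of_seqNorm_le {ι : Type*} [Fintype ι] {p : ℝ≥0∞} (hp : 1 ≤ p) (hp' : p ≠ ∞)
    {a : ι → ℝ} {A : ℝ} (hA : 0 ≤ A) (h : seqNorm p (fun i => ‖a i‖ₑ) ≤ ENNReal.ofReal A) :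
    ∑ i, |a i| ^ p.toReal ≤ A ^ p.toReal := by
  have hp0 : 0 < p.toReal := ENNReal.toReal_pos (zero_lt_one.trans_le hp).ne' hp'
  rw [seqNorm, if_neg hp', tsum_fintype, ENNReal.rpow_inv_le_iff hp0,
    ENNReal.ofReal_rpow_of_nonneg hA hp0.le] at h
  simp only [Real.enorm_eq_ofReal_abs] at h
  rw [Finset.sum_congr rfl fun i _ => ENNReal.ofReal_rpow_of_nonneg (abs_nonneg (a i)) hp0.le,
    ← ENNReal.ofReal_sum_of_nonneg fun i _ => by positivity] at h
  rwa [ENNReal.ofReal_le_ofReal_iff (by positivity)] at h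

/-- Power mean inequality with exponent `p/2 ≥ 1` applied to the squares; `p = ∞` is treated
separately. -/
theorem sum_sq_le_of_seqNorm_le_of_two_le {ι : Type*} [Fintype ι] [Nonempty ι] {p : ℝ≥0∞}
    (hp : 2 ≤ p)
    {a : ι → ℝ} {A : ℝ} (hA : 0 ≤ A) (h : seqNorm p (fun i => ‖a i‖ₑ) ≤ ENNReal.ofReal A) :
    ∑ i, a i ^ 2 ≤ (Fintype.card ι : ℝ) ^ (1 - 2 * (p⁻¹).toReal) * A ^ 2 := by
  have hp1 : 1 ≤ p := one_le_two.trans hp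
  rcases eq_or_ne p ∞ with rfl | hp'
  · simp only [ENNReal.inv_top, ENNReal.toReal_zero, mul_zero, sub_zero, Real.rpow_one]
    calc ∑ i, a i ^ 2 ≤ ∑ _i : ι, A ^ 2 := Finset.sum_le_sum fun i _ => by
          rw [← sq_abs]; gcongr; exact abs_le_of_seqNorm_le hp1 hA h i
      _ = _ := by simp
  · have h1 := sum_rpow_le_of_seqNorm_le hp1 hp' hA h
    have hp2 : 2 ≤ p.toReal := by
      have := ENNReal.toReal_mono hp' hp
      simpa using this
    rw [ENNReal.toReal_inv]
    set r := p.toReal with hr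
    have hN : (0 : ℝ) < Fintype.card ι := by exact_mod_cast Fintype.card_pos
    have h2 := Real.rpow_sum_le_const_mul_sum_rpow Finset.univ (fun i => a i ^ 2) (p := r / 2)
      (by linarith)
    have e1 : ∀ i, (a i ^ 2) ^ (r / 2) = |a i| ^ r := fun i => by
      rw [← sq_abs, ← Real.rpow_natCast, ← Real.rpow_mul (abs_nonneg _)]
      congr 1
      push_cast
      ring
    simp only [abs_pow, sq_abs, e1, Finset.card_univ] at h2
    have h3 : (∑ i, a i ^ 2) ^ (r / 2) ≤
        ((Fintype.card ι : ℝ) ^ (1 - 2 * r⁻¹) * A ^ 2) ^ (r / 2) := by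
      refine h2.trans ?_
      rw [Real.mul_rpow (by positivity) (by positivity), ← Real.rpow_mul hN.le]
      have e2 : (1 - 2 * r⁻¹) * (r / 2) = r / 2 - 1 := by field_simp
      have e3 : (A ^ 2) ^ (r / 2) = A ^ r := by
        rw [← Real.rpow_natCast, ← Real.rpow_mul hA]
        congr 1
        push_cast
        ring
      rw [e2, e3]
      gcongr
    exact (Real.rpow_le_rpow_iff (Finset.sum_nonneg fun i _ => sq_nonneg _) (by positivity)
      (by linarith)).1 h3

/-- The square is split into powers `p` and `2 - p`, and the minimum is bounded by `x` in one and by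
`v` in the other. This is how thresholding exploits sparsity. -/
theorem sq_min_le_rpow {x v p : ℝ} (hx : 0 ≤ x) (hv : 0 ≤ v) (hp0 : 0 < p) (hp2 : p < 2) :
    min x v ^ 2 ≤ x ^ p * v ^ (2 - p) := by
  have h0 : 0 ≤ min x v := le_min hx hv
  calc min x v ^ 2 = min x v ^ p * min x v ^ (2 - p) := by
        rw [← Real.rpow_add_of_nonneg h0 hp0.le (by linarith), ← Real.rpow_natCast]
        congr 1
        push_cast
        ring
    _ ≤ x ^ p * v ^ (2 - p) := by
        have h1 : 0 ≤ 2 - p := by linarith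
        gcongr
        · exact min_le_left _ _
        · exact min_le_right _ _

theorem sum_sq_min_le_of_seqNorm_le {ι : Type*} [Fintype ι] {p : ℝ≥0∞} (hp : 1 ≤ p) (hp2 : p < 2)
    {a : ι → ℝ} {A : ℝ} (hA : 0 ≤ A) (h : seqNorm p (fun i => ‖a i‖ₑ) ≤ ENNReal.ofReal A)
    {v : ℝ} (hv : 0 ≤ v) :
    ∑ i, min |a i| v ^ 2 ≤ A ^ p.toReal * v ^ (2 - p.toReal) := by
  have hp' : p ≠ ∞ := hp2.ne_top
  have hp0 : 0 < p.toReal := ENNReal.toReal_pos (zero_lt_one.trans_le hp).ne' hp'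
  have hp2' : p.toReal < 2 := by
    have := (ENNReal.toReal_lt_toReal hp' (by simp)).2 hp2
    simpa using this
  refine (Finset.sum_le_sum fun i _ => sq_min_le_rpow (abs_nonneg (a i)) hv hp0 hp2').trans ?_
  rw [← Finset.sum_mul]
  gcongr
  exact sum_rpow_le_of_seqNorm_le hp hp' hA h

/-- Truncation at `v = A` changes nothing, since each entry is at most the norm; the truncated bound
then reads `A^p A^(2-p)`. -/
theorem sum_sq_le_of_seqNorm_le_of_lt_two {ι : Type*} [Fintype ι] {p : ℝ≥0∞} (hp : 1 ≤ p)
    (hp2 : p < 2)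
    {a : ι → ℝ} {A : ℝ} (hA : 0 ≤ A) (h : seqNorm p (fun i => ‖a i‖ₑ) ≤ ENNReal.ofReal A) :
    ∑ i, a i ^ 2 ≤ A ^ 2 := by
  have hp2' : p.toReal < 2 := by
    have := (ENNReal.toReal_lt_toReal hp2.ne_top (by simp)).2 hp2
    simpa using this
  have h1 := sum_sq_min_le_of_seqNorm_le hp hp2 hA h hA
  have e : ∀ i, min |a i| A ^ 2 = a i ^ 2 := fun i => by
    rw [min_eq_left (abs_le_of_seqNorm_le hp hA h i), sq_abs]
  simp only [e] at h1
  refine h1.trans_eq ?_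
  rw [← Real.rpow_add_of_nonneg hA ENNReal.toReal_nonneg (by linarith), ← Real.rpow_natCast]
  congr 1
  push_cast
  ring

section BesovLevel

variable {φ ψ f : ℝ → ℝ} {τ : ℕ} {s L : ℝ} {p q : ℝ≥0∞}

/-- Each level term is at most the full `ℓ^q` norm, so the level bounds, and hence the constants,
are free of `q`. -/
theorem seqNorm_coeff_le_of_mem_besovBall (hq : 1 ≤ q) (hf : f ∈ besovBall φ ψ τ s p q L) (i : ℕ) :
    seqNorm p (fun k : Fin (2 ^ (τ + i)) => ‖waveletCoeff ψ f (τ + i) k‖ₑ) ≤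
      ENNReal.ofReal (L * (2 : ℝ) ^ (-(((τ + i : ℕ) : ℝ) * (s + 1 / 2 - (p⁻¹).toReal)))) := by
  have h1 := (le_seqNorm hq (besovTerm φ ψ τ s p f) (i + 1)).trans hf.2
  simp only [besovTerm, besovWeight] at h1
  set E := ((τ + i : ℕ) : ℝ) * (s + 1 / 2 - (p⁻¹).toReal)
  have hw : 0 < (2 : ℝ) ^ E := by positivity
  rw [mul_comm, ← ENNReal.le_div_iff_mul_le (Or.inl (by simpa using hw))
    (Or.inl ENNReal.ofReal_ne_top), ← ENNReal.ofReal_div_of_pos hw] at h1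
  rwa [Real.rpow_neg (by norm_num), ← div_eq_mul_inv]

theorem sum_sq_coeff_le_of_two_le (hL : 0 ≤ L) (hq : 1 ≤ q) (hf : f ∈ besovBall φ ψ τ s p q L)
    (hp : 2 ≤ p) (i : ℕ) :
    ∑ k : Fin (2 ^ (τ + i)), waveletCoeff ψ f (τ + i) k ^ 2 ≤
      L ^ 2 * (2 : ℝ) ^ (-(2 * s * ((τ + i : ℕ) : ℝ))) := by
  refine (sum_sq_le_of_seqNorm_le_of_two_le hp (by positivity)
    (seqNorm_coeff_le_of_mem_besovBall hq hf i)).trans_eq ?_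
  rw [Fintype.card_fin, mul_pow, mul_left_comm]
  congr 1
  push_cast
  rw [← Real.rpow_natCast (2 : ℝ) (τ + i), ← Real.rpow_mul (by norm_num), ← Real.rpow_mul_natCast
    (by norm_num), ← Real.rpow_add (by norm_num)]
  congr 1
  push_cast
  ring

theorem toReal_bounds_of_lt_two (hp : 1 ≤ p) (hp2 : p < 2) (hs : (p⁻¹).toReal < s) :
    1 ≤ p.toReal ∧ p.toReal < 2 ∧ 1 < p.toReal * s ∧ (p⁻¹).toReal = p.toReal⁻¹ := by
  have h1 : 1 ≤ p.toReal := by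
    have := ENNReal.toReal_mono hp2.ne_top hp
    simpa using this
  have h2 : p.toReal < 2 := by
    have := (ENNReal.toReal_lt_toReal hp2.ne_top (by simp)).2 hp2
    simpa using this
  refine ⟨h1, h2, ?_, ENNReal.toReal_inv p⟩
  rw [ENNReal.toReal_inv, inv_lt_iff_one_lt_mul₀ (by linarith)] at hs
  linarith

/-- The exponent `2(s + 1/2 - 1/p)` exceeds one because `s > 1/p`. -/
theorem sum_sq_coeff_le_of_lt_two (hL : 0 ≤ L) (hp1 : 1 ≤ p) (hq : 1 ≤ q)
    (hf : f ∈ besovBall φ ψ τ s p q L) (hp : p < 2) (hs : (p⁻¹).toReal < s) (i : ℕ) :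
    ∑ k : Fin (2 ^ (τ + i)), waveletCoeff ψ f (τ + i) k ^ 2 ≤
      L ^ 2 * (2 : ℝ) ^ (-((τ + i : ℕ) : ℝ)) := by
  refine (sum_sq_le_of_seqNorm_le_of_lt_two hp1 hp (by positivity)
    (seqNorm_coeff_le_of_mem_besovBall hq hf i)).trans ?_
  rw [mul_pow, ← Real.rpow_mul_natCast (by norm_num)]
  gcongr
  · exact one_le_two
  · have : (0 : ℝ) ≤ ((τ + i : ℕ) : ℝ) := by positivity
    push_cast at this ⊢
    nlinarith

theorem sum_sq_min_coeff_le (hL : 0 ≤ L) (hp1 : 1 ≤ p) (hq : 1 ≤ q)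
    (hf : f ∈ besovBall φ ψ τ s p q L) (hp : p < 2) (hs : (p⁻¹).toReal < s) (i : ℕ)
    {v : ℝ} (hv : 0 ≤ v) :
    ∑ k : Fin (2 ^ (τ + i)), min |waveletCoeff ψ f (τ + i) k| v ^ 2 ≤
      L ^ p.toReal * (2 : ℝ) ^ (-(((τ + i : ℕ) : ℝ) * (p.toReal * (s + 1 / 2) - 1))) *
        v ^ (2 - p.toReal) := by
  refine (sum_sq_min_le_of_seqNorm_le hp1 hp (by positivity)
    (seqNorm_coeff_le_of_mem_besovBall hq hf i) hv).trans_eq ?_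
  obtain ⟨h1, h2, h3, h4⟩ := toReal_bounds_of_lt_two hp1 hp hs
  rw [Real.mul_rpow hL (by positivity), ← Real.rpow_mul (by norm_num), h4]
  congr 3
  field_simp

end BesovLevel

/-! ### Sample sizes and rates -/

theorem seven_div_four_le_log {n : ℕ} (hn : 6 ≤ n) : 7 / 4 ≤ Real.log n := by
  have h6 : (6 : ℝ) ≤ n := by exact_mod_cast hn
  rw [Real.le_log_iff_exp_le (by linarith)]
  refine le_trans ?_ h6
  -- Equivalent to `e^7 ≤ 1296`, which follows from the decimal bound on `e`.
  have h1 : Real.exp (7 / 4) ^ 4 ≤ 6 ^ 4 := by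
    rw [← Real.exp_nat_mul, show ((4 : ℕ) : ℝ) * (7 / 4) = ((7 : ℕ) : ℝ) * 1 by norm_num,
      Real.exp_nat_mul]
    calc Real.exp 1 ^ 7 ≤ 2.7182818286 ^ 7 := by
          gcongr; exact Real.exp_one_lt_d9.le
      _ ≤ _ := by norm_num
  exact le_of_pow_le_pow_left₀ (by norm_num) (by norm_num) h1

/-- From `log n ≥ 7/4`, `l < 4n/7 + 1`, hence `m > 3n/7 - 1`. For `n ≥ 6` this exceeds both `1` and
`n/4`. -/
theorem learnSize_bounds {n : ℕ} (hn : 6 ≤ n) :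
    trainSize n + learnSize n = n ∧ 2 ≤ trainSize n ∧ (n : ℝ) ≤ 4 * trainSize n ∧
      0 < learnSize n ∧ (n : ℝ) / Real.log n ≤ learnSize n := by
  have h6 : (6 : ℝ) ≤ n := by exact_mod_cast hn
  have hlog := seven_div_four_le_log hn
  have h1 : (n : ℝ) / Real.log n ≤ learnSize n := Nat.le_ceil _
  have h2 : (learnSize n : ℝ) < n / Real.log n + 1 := Nat.ceil_lt_add_one (by positivity)
  have h3 : (n : ℝ) / Real.log n ≤ 4 / 7 * n := by
    rw [div_le_iff₀ (by linarith)]; nlinarith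
  have h4 : (0 : ℝ) < learnSize n := lt_of_lt_of_le (by positivity) h1
  have h5 : (learnSize n : ℝ) ≤ n := by linarith
  have h5' : learnSize n ≤ n := by exact_mod_cast h5
  have h6' : (trainSize n : ℝ) = n - learnSize n := by
    rw [trainSize, Nat.cast_sub h5']
  refine ⟨Nat.sub_add_cancel h5', ?_, by linarith, by exact_mod_cast h4, h1⟩
  have : (1 : ℝ) < trainSize n := by linarith
  exact_mod_cast this

section Rates

variable {n : ℕ} {s s₀ N : ℝ}

theorem rate_exponent (hs : 0 < s) : -(2 * s) / (2 * s + 1) = 1 / (2 * s + 1) - 1 := by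
  field_simp; ring

/-- The rate equals `n^(1/(2s+1)) / n`, so for `s ≤ N` a factor `n^(1/(2N+1))` is always to spare,
and it absorbs logarithms. -/
theorem rpow_le_rate (hn : 6 ≤ n) (hs : 0 < s) (hsN : s ≤ N) {x : ℝ} (hx : x ≤ 1 / (2 * N + 1)) :
    (n : ℝ) ^ x / n ≤ (n : ℝ) ^ (-(2 * s) / (2 * s + 1)) := by
  have h6 : (6 : ℝ) ≤ n := by exact_mod_cast hn
  rw [rate_exponent hs, Real.rpow_sub_one (by linarith)]
  gcongr
  · linarith
  · exact hx.trans (one_div_le_one_div_of_le (by linarith) (by linarith))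

theorem card_grid_div_learnSize_le (hn : 6 ≤ n) (hs : 0 < s) (hsN : s ≤ N) :
    ((levelGrid n).card : ℝ) / learnSize n ≤
      3 * (2 * (2 * N + 1)) ^ 2 * (n : ℝ) ^ (-(2 * s) / (2 * s + 1)) := by
  have h6 : (6 : ℝ) ≤ n := by exact_mod_cast hn
  have hlog := seven_div_four_le_log hn
  have hlog2 := Real.log_two_gt_d9
  obtain ⟨-, -, -, hl0, hl⟩ := learnSize_bounds hn
  have hN : 0 < 2 * N + 1 := by linarith
  have h1 : ((levelGrid n).card : ℝ) ≤ 3 * Real.log n := by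
    have h2 := Real.natLog_le_logb n 2
    rw [Real.logb, le_div_iff₀ (by push_cast; linarith)] at h2
    rw [levelGrid, Finset.card_range]
    push_cast at h2 ⊢
    have : (0 : ℝ) ≤ Nat.log 2 n := by positivity
    nlinarith
  have h3 : Real.log n ≤ 2 * (2 * N + 1) * (n : ℝ) ^ (1 / (2 * (2 * N + 1))) := by
    have := Real.log_le_rpow_div (x := n) (by linarith) (ε := 1 / (2 * (2 * N + 1)))
      (by positivity)
    rw [div_div_eq_mul_div, div_one] at this
    linarith
  calc ((levelGrid n).card : ℝ) / learnSize n ≤ 3 * Real.log n / (n / Real.log n) := by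
        gcongr
    _ = 3 * Real.log n ^ 2 / n := by field_simp
    _ ≤ 3 * (2 * (2 * N + 1) * (n : ℝ) ^ (1 / (2 * (2 * N + 1)))) ^ 2 / n := by gcongr
    _ = 3 * (2 * (2 * N + 1)) ^ 2 * ((n : ℝ) ^ (1 / (2 * N + 1)) / n) := by
        rw [mul_pow, ← Real.rpow_mul_natCast (by linarith)]
        have : 1 / (2 * (2 * N + 1)) * ((2 : ℕ) : ℝ) = 1 / (2 * N + 1) := by
          push_cast; field_simp
        rw [this]
        ring
    _ ≤ _ := by
        gcongr
        exact rpow_le_rate hn hs hsN le_rfl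

theorem two_pow_div_trainSize_le (hn : 6 ≤ n) (hs : 0 < s) {u : ℕ}
    (hu : (2 : ℝ) ^ u ≤ (n : ℝ) ^ (1 / (2 * s + 1))) :
    (2 : ℝ) ^ u / trainSize n ≤ 4 * (n : ℝ) ^ (-(2 * s) / (2 * s + 1)) := by
  have h6 : (6 : ℝ) ≤ n := by exact_mod_cast hn
  obtain ⟨-, hm2, hm, -, -⟩ := learnSize_bounds hn
  rw [rate_exponent hs, Real.rpow_sub_one (by linarith)]
  calc (2 : ℝ) ^ u / trainSize n ≤ (n : ℝ) ^ (1 / (2 * s + 1)) / (n / 4) := by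
        gcongr; linarith
    _ = _ := by field_simp

theorem two_pow_neg_le (hn : 6 ≤ n) {j₁ : ℕ}
    (hj₁ : (trainSize n : ℝ) / Real.log (trainSize n) ≤ 2 ^ j₁) {ε : ℝ} (hε : 0 < ε) :
    (2 : ℝ) ^ (-(j₁ : ℝ)) ≤ 4 / ε * (n : ℝ) ^ (ε - 1) := by
  have h6 : (6 : ℝ) ≤ n := by exact_mod_cast hn
  obtain ⟨h0, hm2, hm, -, -⟩ := learnSize_bounds hn
  have hm2' : (2 : ℝ) ≤ trainSize n := by exact_mod_cast hm2
  have hmn : (trainSize n : ℝ) ≤ n := by exact_mod_cast (by omega : trainSize n ≤ n)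
  have hlm : 0 < Real.log (trainSize n) := Real.log_pos (by linarith)
  have hln : Real.log (trainSize n) ≤ Real.log n := Real.log_le_log (by linarith) hmn
  rw [Real.rpow_neg (by norm_num), Real.rpow_natCast, Real.rpow_sub_one (by linarith)]
  calc ((2 : ℝ) ^ j₁)⁻¹ ≤ ((trainSize n : ℝ) / Real.log (trainSize n))⁻¹ := by gcongr
    _ = Real.log (trainSize n) / trainSize n := inv_div _ _
    _ ≤ Real.log n / (n / 4) := by gcongr; linarith
    _ ≤ ((n : ℝ) ^ ε / ε) / (n / 4) := by
        gcongr; exact Real.log_le_rpow_div (by linarith) hε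
    _ = _ := by field_simp

/-- Write `2^(-2sj)` as `(2^(-u))^(2s) 2^(-2s(j-u))`: the first factor gives the rate, the second
decays at least as fast as for `s₀`. Here `u` stands either for the critical level or for the
truncation level. -/
theorem two_rpow_smooth_le (hn : 6 ≤ n) (hs₀ : 0 < s₀) (hs : s₀ ≤ s) (hsN : s ≤ N) {K : ℝ}
    (hK : 1 ≤ K) {u j : ℕ} (hu : (2 : ℝ) ^ (-(u : ℝ)) ≤ K * (n : ℝ) ^ (-(1 / (2 * s + 1))))
    (hj : u ≤ j) :
    (2 : ℝ) ^ (-(2 * s * (j : ℝ))) ≤ K ^ (2 * N) * (n : ℝ) ^ (-(2 * s) / (2 * s + 1)) *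
      (2 : ℝ) ^ (-(2 * s₀ * ((j - u : ℕ) : ℝ))) := by
  have h6 : (6 : ℝ) ≤ n := by exact_mod_cast hn
  obtain ⟨d, rfl⟩ := Nat.exists_eq_add_of_le hj
  rw [Nat.add_sub_cancel_left]
  have e : (2 : ℝ) ^ (-(2 * s * ((u + d : ℕ) : ℝ))) =
      ((2 : ℝ) ^ (-(u : ℝ))) ^ (2 * s) * (2 : ℝ) ^ (-(2 * s * (d : ℝ))) := by
    rw [← Real.rpow_mul (by norm_num), ← Real.rpow_add (by norm_num)]
    congr 1
    push_cast
    ring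
  rw [e]
  gcongr
  · calc ((2 : ℝ) ^ (-(u : ℝ))) ^ (2 * s) ≤ (K * (n : ℝ) ^ (-(1 / (2 * s + 1)))) ^ (2 * s) := by
          gcongr; linarith
      _ = K ^ (2 * s) * (n : ℝ) ^ (-(2 * s) / (2 * s + 1)) := by
          rw [Real.mul_rpow (by linarith) (by positivity), ← Real.rpow_mul (by linarith)]
          congr 2
          ring
      _ ≤ _ := by gcongr
  · exact one_le_two

/-- Bias for `p < 2`. The weight at level `u` and the power `2 - p` of the threshold combine into
the rate, and the weight over the remaining `j - u` levels leaves geometric decay. -/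
theorem two_rpow_sparse_le (hn : 6 ≤ n) (hs₀ : 0 < s₀) (hs : s₀ ≤ s) (hsN : s ≤ N) {p : ℝ}
    (hp1 : 1 ≤ p) (hp2 : p < 2) (hps : 1 < p * s) {u j : ℕ}
    (hu : (n : ℝ) ^ (1 / (2 * s + 1)) ≤ 2 ^ (u + 1)) (hj : u ≤ j) {L C : ℝ} (hL : 0 ≤ L)
    (hC : 0 ≤ C) :
    L ^ p * (2 : ℝ) ^ (-((j : ℝ) * (p * (s + 1 / 2) - 1))) *
        (C * Real.sqrt (((j - u : ℕ) : ℝ) / trainSize n)) ^ (2 - p) ≤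
      (1 + L) ^ 2 * (1 + C) ^ 2 * (2 : ℝ) ^ (2 * N) * 4 * (n : ℝ) ^ (-(2 * s) / (2 * s + 1)) *
        ((((j - u : ℕ) : ℝ) + 1) * (2 : ℝ) ^ (-(((j - u : ℕ) : ℝ) / 4))) := by
  have h6 : (6 : ℝ) ≤ n := by exact_mod_cast hn
  have hn0 : (0 : ℝ) < n := by linarith
  obtain ⟨h0, hm2, hm, -, -⟩ := learnSize_bounds hn
  obtain ⟨d, rfl⟩ := Nat.exists_eq_add_of_le hj
  rw [Nat.add_sub_cancel_left]
  have hs0 : 0 < s := by linarith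
  set E := p * (s + 1 / 2) - 1 with hE
  have hE1 : 1 / 2 ≤ E := by rw [hE]; linarith
  have hE2 : E ≤ 2 * N := by rw [hE]; nlinarith
  set c := 1 / (2 * s + 1) with hc
  have hc0 : 0 < c := by positivity
  have h1 : L ^ p ≤ (1 + L) ^ 2 := by
    calc L ^ p ≤ (1 + L) ^ p := by gcongr; linarith
      _ ≤ (1 + L) ^ (2 : ℝ) := by gcongr; linarith
      _ = _ := by norm_cast
  have h2 : C ^ (2 - p) ≤ (1 + C) ^ 2 := by
    calc C ^ (2 - p) ≤ (1 + C) ^ (2 - p) := by gcongr; linarith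
      _ ≤ (1 + C) ^ (2 : ℝ) := by gcongr <;> linarith
      _ = _ := by norm_cast
  have h3 : (2 : ℝ) ^ (-((u : ℝ) * E)) ≤ (2 : ℝ) ^ (2 * N) * (n : ℝ) ^ (-(c * E)) := by
    have h4 : ((n : ℝ) ^ c) ^ E ≤ ((2 : ℝ) ^ (u + 1)) ^ E := by gcongr
    have e1 : ((2 : ℝ) ^ (u + 1)) ^ E = (2 : ℝ) ^ ((u : ℝ) * E) * 2 ^ E := by
      rw [← Real.rpow_natCast, ← Real.rpow_mul (by norm_num), ← Real.rpow_add (by norm_num)]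
      congr 1
      push_cast
      ring
    rw [← Real.rpow_mul hn0.le, e1] at h4
    have h5 : (2 : ℝ) ^ E ≤ 2 ^ (2 * N) := by gcongr; exact one_le_two
    rw [Real.rpow_neg (by norm_num), Real.rpow_neg hn0.le, ← div_eq_mul_inv,
      inv_le_comm₀ (by positivity) (by positivity), inv_div, div_le_iff₀ (by positivity)]
    refine h4.trans ?_
    gcongr
  have h4 : Real.sqrt ((d : ℝ) / trainSize n) ^ (2 - p) ≤
      4 * (n : ℝ) ^ (-(1 - p / 2)) * ((d : ℝ) + 1) := by
    have hm0 : (0 : ℝ) < trainSize n := by linarith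
    calc Real.sqrt ((d : ℝ) / trainSize n) ^ (2 - p)
        = ((d : ℝ) / trainSize n) ^ (1 - p / 2) := by
          rw [Real.sqrt_eq_rpow, ← Real.rpow_mul (by positivity)]
          congr 1
          ring
      _ ≤ (4 * ((d : ℝ) + 1) / n) ^ (1 - p / 2) := by
          have : (d : ℝ) / trainSize n ≤ 4 * ((d : ℝ) + 1) / n := by
            rw [div_le_div_iff₀ hm0 hn0]
            have : (0 : ℝ) ≤ d := by positivity
            nlinarith
          gcongr
          linarith
      _ = (4 * ((d : ℝ) + 1)) ^ (1 - p / 2) * (n : ℝ) ^ (-(1 - p / 2)) := by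
          rw [Real.div_rpow (by positivity) hn0.le, Real.rpow_neg hn0.le, div_eq_mul_inv]
      _ ≤ (4 * ((d : ℝ) + 1)) ^ (1 : ℝ) * (n : ℝ) ^ (-(1 - p / 2)) := by
          have : (0 : ℝ) ≤ d := by positivity
          gcongr <;> linarith
      _ = _ := by rw [Real.rpow_one]; ring
  have h5 : (2 : ℝ) ^ (-((d : ℝ) * E)) ≤ (2 : ℝ) ^ (-((d : ℝ) / 4)) := by
    have : (0 : ℝ) ≤ d := by positivity
    gcongr
    · exact one_le_two
    · nlinarith
  have e2 : (2 : ℝ) ^ (-(((u + d : ℕ) : ℝ) * E)) =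
      (2 : ℝ) ^ (-((u : ℝ) * E)) * (2 : ℝ) ^ (-((d : ℝ) * E)) := by
    rw [← Real.rpow_add (by norm_num)]
    congr 1
    push_cast
    ring
  -- As `c E = p/2 - 1/(2s+1)`, adding `1 - p/2` cancels `p` and leaves `2s/(2s+1)`.
  have e3 : (n : ℝ) ^ (-(2 * s) / (2 * s + 1)) = (n : ℝ) ^ (-(c * E)) * (n : ℝ) ^ (-(1 - p / 2)) := by
    rw [← Real.rpow_add hn0]
    congr 1
    rw [hc, hE]
    field_simp
    ring
  rw [e2, e3, Real.mul_rpow hC (by positivity)]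
  calc _ ≤ (1 + L) ^ 2 * (((2 : ℝ) ^ (2 * N) * (n : ℝ) ^ (-(c * E))) *
        (2 : ℝ) ^ (-((d : ℝ) / 4))) *
        ((1 + C) ^ 2 * (4 * (n : ℝ) ^ (-(1 - p / 2)) * ((d : ℝ) + 1))) := by gcongr
    _ = _ := by ring

theorem exists_level (hn : 6 ≤ n) (hs : 0 < s) :
    ∃ u ∈ levelGrid n, (2 : ℝ) ^ u ≤ (n : ℝ) ^ (1 / (2 * s + 1)) ∧
      (n : ℝ) ^ (1 / (2 * s + 1)) ≤ 2 ^ (u + 1) := by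
  have h6 : (6 : ℝ) ≤ n := by exact_mod_cast hn
  obtain ⟨u, h1, h2⟩ := exists_nat_pow_near (x := (n : ℝ) ^ (1 / (2 * s + 1))) (y := 2)
    (Real.one_le_rpow (by linarith) (by positivity)) one_lt_two
  refine ⟨u, ?_, h1, h2.le⟩
  have h3 : (2 : ℝ) ^ u ≤ n := by
    refine h1.trans ?_
    calc (n : ℝ) ^ (1 / (2 * s + 1)) ≤ (n : ℝ) ^ (1 : ℝ) := by
          gcongr
          · linarith
          · rw [div_le_one (by positivity)]; linarith
      _ = n := Real.rpow_one _
  rw [levelGrid, Finset.mem_range, Nat.lt_succ_iff]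
  exact Nat.le_log_of_pow_le (by norm_num) (by exact_mod_cast h3)

end Rates

/-! ### Summable majorant of the level risks -/

/-- Decay of the level risks away from a critical level. -/
noncomputable def levelDecay (s₀ : ℝ) (d : ℕ) : ℝ :=
  (2 : ℝ) ^ (-(2 * s₀ * (d : ℝ))) + ((d : ℝ) + 1) * (2 : ℝ) ^ (-((d : ℝ) / 4))

theorem levelDecay_nonneg (s₀ : ℝ) (d : ℕ) : 0 ≤ levelDecay s₀ d := by
  unfold levelDecay; positivity

theorem summable_levelDecay {s₀ : ℝ} (hs₀ : 0 < s₀) : Summable (levelDecay s₀) := by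
  have e : ∀ a : ℝ, ∀ d : ℕ, (2 : ℝ) ^ (-(a * (d : ℝ))) = ((2 : ℝ) ^ (-a)) ^ d := fun a d => by
    rw [← Real.rpow_mul_natCast (by norm_num)]; congr 1; ring
  have hlt : ∀ a : ℝ, 0 < a → (2 : ℝ) ^ (-a) < 1 := fun a ha =>
    Real.rpow_lt_one_of_one_lt_of_neg one_lt_two (by linarith)
  have h1 : Summable fun d : ℕ => (2 : ℝ) ^ (-(2 * s₀ * (d : ℝ))) := by
    simp only [e (2 * s₀)]
    exact summable_geometric_of_lt_one (by positivity) (hlt _ (by linarith))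
  have h2 : Summable fun d : ℕ => ((d : ℝ) + 1) * (2 : ℝ) ^ (-((d : ℝ) / 4)) := by
    have e' : ∀ d : ℕ, ((d : ℝ) + 1) * (2 : ℝ) ^ (-((d : ℝ) / 4)) =
        (d : ℝ) ^ 1 * ((2 : ℝ) ^ (-(1 / 4) : ℝ)) ^ d + ((2 : ℝ) ^ (-(1 / 4) : ℝ)) ^ d :=
      fun d => by
        rw [← e (1 / 4), pow_one, add_mul, one_mul]; ring_nf
    simp only [e']
    have hn : ‖(2 : ℝ) ^ (-(1 / 4) : ℝ)‖ < 1 := by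
      rw [Real.norm_of_nonneg (by positivity)]; exact hlt _ (by norm_num)
    exact (summable_pow_mul_geometric_of_norm_lt_one 1 hn).add (summable_geometric_of_norm_lt_one hn)
  exact h1.add h2

/-- Majorant of the risk at level `j`, up to constants and the rate, for a threshold which starts
at level `u` and a truncation at level `j₁`. -/
noncomputable def levelProfile (s₀ : ℝ) (J u j₁ j : ℕ) : ℝ :=
  (if j ≤ u then (2 : ℝ) ^ j / 2 ^ u else 0) + (if j < J then 1 else 0) +
    (if u < j then levelDecay s₀ (j - u) else 0) + (if j₁ < j then levelDecay s₀ (j - j₁) else 0)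

theorem tsum_ite_lt_sub_le (G : ℕ → ℝ≥0∞) (u : ℕ) :
    ∑' j, (if u < j then G (j - u) else 0) ≤ ∑' d, G d := by
  rw [← (add_left_injective u).tsum_eq (f := fun j => if u < j then G (j - u) else 0)]
  · refine ENNReal.tsum_le_tsum fun d => ?_
    simp only [Nat.add_sub_cancel]
    split_ifs <;> simp
  · intro j hj
    simp only [Function.mem_support, ne_eq, ite_eq_right_iff, Classical.not_imp] at hj
    exact ⟨j - u, by simp only; omega⟩

theorem tsum_levelProfile_le {s₀ : ℝ} (hs₀ : 0 < s₀) (τ J u j₁ : ℕ) :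
    ∑' i, ENNReal.ofReal (levelProfile s₀ J u j₁ (τ + i)) ≤
      ENNReal.ofReal (2 + J + 2 * ∑' d, levelDecay s₀ d) := by
  refine (ENNReal.tsum_comp_le_tsum_of_injective (add_right_injective τ)
    (fun j => ENNReal.ofReal (levelProfile s₀ J u j₁ j))).trans ?_
  have hd := levelDecay_nonneg s₀
  have hS : ∑' d, ENNReal.ofReal (levelDecay s₀ d) = ENNReal.ofReal (∑' d, levelDecay s₀ d) :=
    (ENNReal.ofReal_tsum_of_nonneg hd (summable_levelDecay hs₀)).symm
  have e : ∀ j, ENNReal.ofReal (levelProfile s₀ J u j₁ j) =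
      ENNReal.ofReal (if j ≤ u then (2 : ℝ) ^ j / 2 ^ u else 0) +
      ENNReal.ofReal (if j < J then 1 else 0) +
      (if u < j then ENNReal.ofReal (levelDecay s₀ (j - u)) else 0) +
      (if j₁ < j then ENNReal.ofReal (levelDecay s₀ (j - j₁)) else 0) := fun j => by
    have h1 : (0 : ℝ) ≤ if j ≤ u then (2 : ℝ) ^ j / 2 ^ u else 0 := by split_ifs <;> positivity
    have h2 : (0 : ℝ) ≤ if j < J then 1 else 0 := by split_ifs <;> positivity
    have h3 : ∀ v, (0 : ℝ) ≤ if v < j then levelDecay s₀ (j - v) else 0 := fun v => by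
      split_ifs
      · exact hd _
      · exact le_rfl
    rw [levelProfile, ENNReal.ofReal_add (by have := h3 u; positivity) (h3 _),
      ENNReal.ofReal_add (by positivity) (h3 _), ENNReal.ofReal_add h1 h2]
    congr 1
    · congr 1
      split_ifs <;> simp
    · split_ifs <;> simp
  simp only [e]
  rw [ENNReal.tsum_add, ENNReal.tsum_add, ENNReal.tsum_add]
  have t1 : ∑' j, ENNReal.ofReal (if j ≤ u then (2 : ℝ) ^ j / 2 ^ u else 0) ≤
      ENNReal.ofReal 2 := by
    rw [tsum_eq_sum (s := Finset.range (u + 1)) (fun j hj => by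
      rw [if_neg (by simpa using hj)]; simp), ← ENNReal.ofReal_sum_of_nonneg
      (fun j _ => by split_ifs <;> positivity)]
    refine ENNReal.ofReal_le_ofReal ?_
    rw [Finset.sum_congr rfl fun j hj => if_pos (by simpa [Nat.lt_succ_iff] using hj),
      ← Finset.sum_div, div_le_iff₀ (by positivity), geom_sum_eq (by norm_num)]
    have : (2 : ℝ) ^ (u + 1) = 2 * 2 ^ u := by ring
    linarith
  have t2 : ∑' j, ENNReal.ofReal (if j < J then 1 else 0) ≤ ENNReal.ofReal J := by
    rw [tsum_eq_sum (s := Finset.range J) (fun j hj => by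
      rw [if_neg (by simpa using hj)]; simp), ← ENNReal.ofReal_sum_of_nonneg
      (fun j _ => by split_ifs <;> positivity)]
    refine ENNReal.ofReal_le_ofReal ?_
    rw [Finset.sum_congr rfl fun j hj => if_pos (by simpa using hj)]
    simp
  have t3 := fun v => (tsum_ite_lt_sub_le (fun d => ENNReal.ofReal (levelDecay s₀ d)) v).trans_eq hS
  have hS0 : 0 ≤ ∑' d, levelDecay s₀ d := tsum_nonneg hd
  refine (add_le_add (add_le_add (add_le_add t1 t2) (t3 u)) (t3 j₁)).trans_eq ?_
  rw [← ENNReal.ofReal_add (by positivity) (by positivity), ← ENNReal.ofReal_add (by positivity)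
    (by positivity), ← ENNReal.ofReal_add (by positivity) (by positivity)]
  congr 1
  ring

/-! ### Risk at each level -/

section Levels

variable {φ ψ f : ℝ → ℝ} {τ : ℕ} {s s₀ N L : ℝ} {p q : ℝ≥0∞} {n : ℕ}

theorem smooth_le_levelDecay (s₀ : ℝ) (d : ℕ) : (2 : ℝ) ^ (-(2 * s₀ * (d : ℝ))) ≤ levelDecay s₀ d := by
  unfold levelDecay
  exact le_add_of_nonneg_right (by positivity)

theorem sparse_le_levelDecay (s₀ : ℝ) (d : ℕ) :
    ((d : ℝ) + 1) * (2 : ℝ) ^ (-((d : ℝ) / 4)) ≤ levelDecay s₀ d := by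
  unfold levelDecay
  exact le_add_of_nonneg_left (by positivity)

theorem quarter_le_levelDecay (s₀ : ℝ) (d : ℕ) : (2 : ℝ) ^ (-((d : ℝ) / 4)) ≤ levelDecay s₀ d := by
  refine le_trans ?_ (sparse_le_levelDecay s₀ d)
  exact le_mul_of_one_le_left (by positivity) (by linarith [(Nat.cast_nonneg d : (0 : ℝ) ≤ d)])

/-- For `p ≥ 2`, `ε = 2s₀/(2s₀+1)` in `two_pow_neg_le` makes `2^(-j₁)` at most a constant times
`n^(-1/(2s+1))`. For `p < 2`, where only `2^(-j)` decay is available, `ε = 1/(2N+1)` already bounds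
`2^(-j₁)` by the rate. -/
theorem sum_sq_coeff_tail_le (hn : 6 ≤ n) (hs₀ : 0 < s₀) (hs : s₀ ≤ s) (hsN : s ≤ N) (hL : 0 ≤ L)
    (hp : 1 ≤ p) (hq : 1 ≤ q) (hps : (p⁻¹).toReal < s) (hf : f ∈ besovBall φ ψ τ s p q L) {j₁ : ℕ}
    (hj₁ : (trainSize n : ℝ) / Real.log (trainSize n) ≤ 2 ^ j₁) {i : ℕ} (hi : j₁ < τ + i) :
    ∑ k : Fin (2 ^ (τ + i)), waveletCoeff ψ f (τ + i) k ^ 2 ≤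
      (L ^ 2 * (4 / (2 * s₀ / (2 * s₀ + 1))) ^ (2 * N) + L ^ 2 * (4 / (1 / (2 * N + 1)))) *
        (n : ℝ) ^ (-(2 * s) / (2 * s + 1)) * levelDecay s₀ (τ + i - j₁) := by
  have h6 : (6 : ℝ) ≤ n := by exact_mod_cast hn
  have hN : 0 < 2 * N + 1 := by linarith
  have hD := levelDecay_nonneg s₀ (τ + i - j₁)
  rcases le_or_gt 2 p with h2 | h2
  · have hε : 0 < 2 * s₀ / (2 * s₀ + 1) := by positivity
    have hK : 1 ≤ 4 / (2 * s₀ / (2 * s₀ + 1)) := by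
      rw [le_div_iff₀ hε, one_mul, div_le_iff₀ (by positivity)]; linarith
    have hu : (2 : ℝ) ^ (-(j₁ : ℝ)) ≤ 4 / (2 * s₀ / (2 * s₀ + 1)) *
        (n : ℝ) ^ (-(1 / (2 * s + 1))) := by
      refine (two_pow_neg_le hn hj₁ hε).trans ?_
      have : 2 * s₀ / (2 * s₀ + 1) - 1 ≤ -(1 / (2 * s + 1)) := by
        have e : 2 * s₀ / (2 * s₀ + 1) - 1 = -(1 / (2 * s₀ + 1)) := by field_simp; ring
        rw [e, neg_le_neg_iff]
        exact one_div_le_one_div_of_le (by linarith) (by linarith)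
      gcongr
      linarith
    refine (sum_sq_coeff_le_of_two_le hL hq hf h2 i).trans ?_
    have h3 := two_rpow_smooth_le hn hs₀ hs hsN hK hu hi.le
    calc L ^ 2 * (2 : ℝ) ^ (-(2 * s * ((τ + i : ℕ) : ℝ)))
        ≤ L ^ 2 * ((4 / (2 * s₀ / (2 * s₀ + 1))) ^ (2 * N) * (n : ℝ) ^ (-(2 * s) / (2 * s + 1)) *
          levelDecay s₀ (τ + i - j₁)) := by
          refine mul_le_mul_of_nonneg_left (h3.trans ?_) (by positivity)
          gcongr
          exact smooth_le_levelDecay _ _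
      _ = L ^ 2 * (4 / (2 * s₀ / (2 * s₀ + 1))) ^ (2 * N) * (n : ℝ) ^ (-(2 * s) / (2 * s + 1)) *
          levelDecay s₀ (τ + i - j₁) := by ring
      _ ≤ _ := by
          gcongr
          exact le_add_of_nonneg_right (by positivity)
  · refine (sum_sq_coeff_le_of_lt_two hL hp hq hf h2 hps i).trans ?_
    have hu : (2 : ℝ) ^ (-(j₁ : ℝ)) ≤ 4 / (1 / (2 * N + 1)) *
        (n : ℝ) ^ (-(2 * s) / (2 * s + 1)) := by
      refine (two_pow_neg_le hn hj₁ (ε := 1 / (2 * N + 1)) (by positivity)).trans ?_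
      have := rpow_le_rate hn (by linarith) hsN le_rfl
      rw [← Real.rpow_sub_one (by linarith)] at this
      gcongr
    have e : (2 : ℝ) ^ (-((τ + i : ℕ) : ℝ)) =
        (2 : ℝ) ^ (-(j₁ : ℝ)) * (2 : ℝ) ^ (-((τ + i - j₁ : ℕ) : ℝ)) := by
      rw [← Real.rpow_add (by norm_num), Nat.cast_sub hi.le]
      congr 1
      ring
    have h3 : (2 : ℝ) ^ (-((τ + i - j₁ : ℕ) : ℝ)) ≤ levelDecay s₀ (τ + i - j₁) := by
      refine le_trans ?_ (quarter_le_levelDecay _ _)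
      have : (0 : ℝ) ≤ ((τ + i - j₁ : ℕ) : ℝ) := by positivity
      gcongr
      · exact one_le_two
      · linarith
    rw [e]
    calc _ ≤ L ^ 2 * (4 / (1 / (2 * N + 1)) * (n : ℝ) ^ (-(2 * s) / (2 * s + 1)) *
          levelDecay s₀ (τ + i - j₁)) := by gcongr
      _ = L ^ 2 * (4 / (1 / (2 * N + 1))) * (n : ℝ) ^ (-(2 * s) / (2 * s + 1)) *
          levelDecay s₀ (τ + i - j₁) := by ring
      _ ≤ _ := by
          gcongr
          exact le_add_of_nonneg_left (by positivity)

theorem sum_sq_min_threshold_le (hn : 6 ≤ n) (hs₀ : 0 < s₀) (hs : s₀ ≤ s) (hsN : s ≤ N)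
    (hL : 0 ≤ L) (hp : 1 ≤ p) (hq : 1 ≤ q) (hps : (p⁻¹).toReal < s)
    (hf : f ∈ besovBall φ ψ τ s p q L) {u : ℕ} (hu : (n : ℝ) ^ (1 / (2 * s + 1)) ≤ 2 ^ (u + 1))
    {ρ C₂ : ℝ} (hρ : 0 < ρ) (hC₂ : 0 < C₂) {i : ℕ} (hi : u < τ + i) :
    ∑ k : Fin (2 ^ (τ + i)), min |waveletCoeff ψ f (τ + i) k|
        (C₂ * levelThreshold ρ (trainSize n) u (τ + i)) ^ 2 ≤
      (L ^ 2 * 2 ^ (2 * N) + (1 + L) ^ 2 * (1 + C₂ * ρ) ^ 2 * (2 : ℝ) ^ (2 * N) * 4) *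
        (n : ℝ) ^ (-(2 * s) / (2 * s + 1)) * levelDecay s₀ (τ + i - u) := by
  have h6 : (6 : ℝ) ≤ n := by exact_mod_cast hn
  have hD := levelDecay_nonneg s₀ (τ + i - u)
  have hlam : 0 ≤ C₂ * levelThreshold ρ (trainSize n) u (τ + i) := by
    unfold levelThreshold; positivity
  rcases le_or_gt 2 p with h2 | h2
  · have hu' : (2 : ℝ) ^ (-(u : ℝ)) ≤ 2 * (n : ℝ) ^ (-(1 / (2 * s + 1))) := by
      rw [Real.rpow_neg (by norm_num), Real.rpow_neg (by linarith), Real.rpow_natCast,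
        ← div_eq_mul_inv, inv_le_comm₀ (by positivity) (by positivity), inv_div,
        div_le_iff₀ (by norm_num), ← pow_succ]
      exact hu
    have h3 := two_rpow_smooth_le hn hs₀ hs hsN one_le_two hu' hi.le
    calc _ ≤ ∑ k : Fin (2 ^ (τ + i)), waveletCoeff ψ f (τ + i) k ^ 2 := by
          refine Finset.sum_le_sum fun k _ => ?_
          rw [← sq_abs (waveletCoeff _ _ _ _)]
          exact pow_le_pow_left₀ (le_min (abs_nonneg _) hlam) (min_le_left _ _) 2
      _ ≤ L ^ 2 * (2 : ℝ) ^ (-(2 * s * ((τ + i : ℕ) : ℝ))) :=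
          sum_sq_coeff_le_of_two_le hL hq hf h2 i
      _ ≤ L ^ 2 * (2 ^ (2 * N) * (n : ℝ) ^ (-(2 * s) / (2 * s + 1)) *
          levelDecay s₀ (τ + i - u)) := by
          refine mul_le_mul_of_nonneg_left (h3.trans ?_) (by positivity)
          gcongr
          exact smooth_le_levelDecay _ _
      _ = L ^ 2 * 2 ^ (2 * N) * (n : ℝ) ^ (-(2 * s) / (2 * s + 1)) *
          levelDecay s₀ (τ + i - u) := by ring
      _ ≤ _ := by
          gcongr
          exact le_add_of_nonneg_right (by positivity)
  · refine (sum_sq_min_coeff_le hL hp hq hf h2 hps i hlam).trans ?_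
    obtain ⟨h3, h4, h5, -⟩ := toReal_bounds_of_lt_two hp h2 hps
    have e : C₂ * levelThreshold ρ (trainSize n) u (τ + i) =
        C₂ * ρ * Real.sqrt (((τ + i - u : ℕ) : ℝ) / trainSize n) := by
      rw [levelThreshold, mul_assoc]
    rw [e]
    refine (two_rpow_sparse_le hn hs₀ hs hsN h3 h4 h5 hu hi.le hL (C := C₂ * ρ)
      (by positivity)).trans ?_
    gcongr
    · exact le_add_of_nonneg_left (by positivity)
    · exact sparse_le_levelDecay _ _

end Levels

/-! ### Risk of the thresholded estimator -/

theorem levelProfile_bounds (s₀ : ℝ) (J u j₁ j : ℕ) :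
    0 ≤ levelProfile s₀ J u j₁ j ∧
    (j ≤ u → (2 : ℝ) ^ j / 2 ^ u ≤ levelProfile s₀ J u j₁ j) ∧
    (j < J → 1 ≤ levelProfile s₀ J u j₁ j) ∧
    (u < j → levelDecay s₀ (j - u) ≤ levelProfile s₀ J u j₁ j) ∧
    (j₁ < j → levelDecay s₀ (j - j₁) ≤ levelProfile s₀ J u j₁ j) := by
  have h1 : (0 : ℝ) ≤ if j ≤ u then (2 : ℝ) ^ j / 2 ^ u else 0 := by split_ifs <;> positivity
  have h2 : (0 : ℝ) ≤ if j < J then 1 else 0 := by split_ifs <;> positivity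
  have h3 : ∀ v, (0 : ℝ) ≤ if v < j then levelDecay s₀ (j - v) else 0 := fun v => by
    split_ifs
    · exact levelDecay_nonneg s₀ _
    · exact le_rfl
  have h4 := h3 u
  have h5 := h3 j₁
  unfold levelProfile
  refine ⟨by positivity, fun h => ?_, fun h => ?_, fun h => ?_, fun h => ?_⟩
  · rw [if_pos h] at h1 ⊢; linarith
  · rw [if_pos h] at h2 ⊢; linarith
  · rw [if_pos h] at h4 ⊢; linarith
  · rw [if_pos h] at h5 ⊢; linarith

theorem measurable_coeffEstimate {g : ℝ → ℝ} (hg : Measurable g) {m : ℕ} (j k : ℕ) :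
    Measurable fun D : Fin m → ℝ × ℝ => coeffEstimate g D j k := by
  have := measurable_perWavelet hg j k
  unfold coeffEstimate
  fun_prop

/-- Here `2m / log m` is at most `14 / log 2 < 32`. So levels from `5` on occur only with `m ≥ 8`,
where the exponential bound applies. -/
theorem lt_five_of_trainSize_lt_eight {m j : ℕ} (hm2 : 2 ≤ m) (hm : m < 8)
    (hj : (2 : ℝ) ^ j < 2 * ((m : ℝ) / Real.log m)) : j < 5 := by
  by_contra hc
  have h2 : (2 : ℝ) ≤ m := by exact_mod_cast hm2
  have h8 : (m : ℝ) ≤ 7 := by exact_mod_cast (by omega : m ≤ 7)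
  have hlog2 := Real.log_two_gt_d9
  have hlog : Real.log 2 ≤ Real.log m := Real.log_le_log (by norm_num) h2
  have h1 : (2 : ℝ) ^ 5 ≤ 2 ^ j := pow_le_pow_right₀ one_le_two (by omega)
  have h3 : (m : ℝ) / Real.log m ≤ 16 := by
    rw [div_le_iff₀ (by linarith)]; linarith
  linarith

section NoiseLevels

variable {φ ψ f : ℝ → ℝ} {τ : ℕ} {s s₀ : ℝ} {n : ℕ} {π : Measure (ℝ × ℝ)}

theorem ite_sq_le_sq (t x : ℝ) : (if t ≤ |x| then |x| ^ 2 else 0) ≤ x ^ 2 := by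
  split_ifs
  · rw [sq_abs]
  · positivity

theorem lintegral_noise_crude_le (h : IsPeriodizedWaveletBasis φ ψ τ)
    (hπ : IsBoundedRegression π f) {m : ℕ} (hm : 0 < m) (t : ℝ) (i : ℕ) (k : Fin (2 ^ (τ + i))) :
    ∫⁻ D : Fin m → ℝ × ℝ, ENNReal.ofReal
      (if t ≤ |coeffEstimate ψ D (τ + i) k - waveletCoeff ψ f (τ + i) k| then
        |coeffEstimate ψ D (τ + i) k - waveletCoeff ψ f (τ + i) k| ^ 2 else 0)
      ∂(Measure.pi fun _ => π) ≤ ENNReal.ofReal (1 / m) :=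
  (lintegral_mono fun _ => ENNReal.ofReal_le_ofReal (ite_sq_le_sq _ _)).trans
    (h.lintegral_sq_mother_le hπ hm i k)

/-- The variance bound `1/m` suffices up to level `u`, and below `J`, where the number of
coefficients is bounded; elsewhere the exponential tail takes over. -/
theorem sum_lintegral_noise_le (h : IsPeriodizedWaveletBasis φ ψ τ)
    (hπ : IsBoundedRegression π f) {ρ : ℝ} (hρ : 0 < ρ)
    (hρψ : 4 * Real.log 2 ≤ ρ ^ 2 / (8 + 8 * ρ / (3 * Real.sqrt 2) * (supNorm ψ + 1)))
    {J : ℕ} (hJ5 : 5 ≤ J) (hJ : ∀ j, J ≤ j → ∀ k, ∀ᵐ x ∂unitVolume,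
      |perWavelet ψ j k x| ≤ (2 : ℝ) ^ ((j : ℝ) / 2) * supNorm ψ)
    (hn : 6 ≤ n) (hs : 0 < s) {u j₁ : ℕ} (hu : (2 : ℝ) ^ u ≤ (n : ℝ) ^ (1 / (2 * s + 1)))
    (hj₁ : (2 : ℝ) ^ j₁ < 2 * ((trainSize n : ℝ) / Real.log (trainSize n)))
    {i : ℕ} (hi : τ + i ≤ j₁) :
    ∑ k : Fin (2 ^ (τ + i)), ∫⁻ D : Fin (trainSize n) → ℝ × ℝ, ENNReal.ofReal
      (if levelThreshold ρ (trainSize n) u (τ + i) / 2 ≤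
          |coeffEstimate ψ D (τ + i) k - waveletCoeff ψ f (τ + i) k| then
        |coeffEstimate ψ D (τ + i) k - waveletCoeff ψ f (τ + i) k| ^ 2 else 0)
      ∂(Measure.pi fun _ => π) ≤
    ENNReal.ofReal (4 * (2 ^ J + 1024 * (2 + 0.85 * ρ * (supNorm ψ + 1)) ^ 2 / ρ ^ 2) *
      (n : ℝ) ^ (-(2 * s) / (2 * s + 1)) * levelProfile s₀ J u j₁ (τ + i)) := by
  obtain ⟨-, hm2, -, -, -⟩ := learnSize_bounds hn
  have hm0 : 0 < trainSize n := by omega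
  have hm' : (0 : ℝ) < trainSize n := by exact_mod_cast hm0
  have hum := two_pow_div_trainSize_le hn hs hu
  set K := 1024 * (2 + 0.85 * ρ * (supNorm ψ + 1)) ^ 2 / ρ ^ 2 with hK
  have hK0 : 0 ≤ K := by positivity
  set R := (n : ℝ) ^ (-(2 * s) / (2 * s + 1)) with hR
  have hR0 : 0 ≤ R := by positivity
  have hD := levelDecay_nonneg s₀
  have hJ1 : (1 : ℝ) ≤ 2 ^ J := one_le_pow₀ one_le_two
  have hcard : ∀ B : ℝ, 0 ≤ B → ∑ _k : Fin (2 ^ (τ + i)), ENNReal.ofReal B =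
      ENNReal.ofReal ((2 : ℝ) ^ (τ + i) * B) := fun B hB => by
    rw [← ENNReal.ofReal_sum_of_nonneg fun _ _ => hB]
    simp
  rcases le_or_gt (τ + i) u with h1 | h1
  · refine (Finset.sum_le_sum fun k _ => lintegral_noise_crude_le h hπ hm0 _ i k).trans ?_
    rw [hcard _ (by positivity)]
    refine ENNReal.ofReal_le_ofReal ?_
    have hprof : (2 : ℝ) ^ (τ + i) / 2 ^ u ≤ levelProfile s₀ J u j₁ (τ + i) :=
      (levelProfile_bounds s₀ J u j₁ (τ + i)).2.1 h1
    calc (2 : ℝ) ^ (τ + i) * (1 / trainSize n) =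
          (2 : ℝ) ^ u / trainSize n * ((2 : ℝ) ^ (τ + i) / 2 ^ u) := by field_simp
      _ ≤ 4 * R * levelProfile s₀ J u j₁ (τ + i) := by gcongr
      _ ≤ 4 * (2 ^ J + K) * R * levelProfile s₀ J u j₁ (τ + i) := by
          have : 0 ≤ levelProfile s₀ J u j₁ (τ + i) := le_trans (by positivity) hprof
          gcongr
          linarith
  rcases lt_or_ge (τ + i) J with h2 | h2
  · refine (Finset.sum_le_sum fun k _ => lintegral_noise_crude_le h hπ hm0 _ i k).trans ?_
    rw [hcard _ (by positivity)]
    refine ENNReal.ofReal_le_ofReal ?_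
    have hprof : 1 ≤ levelProfile s₀ J u j₁ (τ + i) :=
      (levelProfile_bounds s₀ J u j₁ (τ + i)).2.2.1 h2
    calc (2 : ℝ) ^ (τ + i) * (1 / trainSize n) ≤ 2 ^ J * (2 ^ u / trainSize n) := by
          gcongr
          · exact one_le_two
          · exact one_le_pow₀ one_le_two
      _ ≤ 2 ^ J * (4 * R) := by gcongr
      _ = 4 * (2 ^ J + 0) * R * 1 := by ring
      _ ≤ _ := by gcongr
  · have hm8 : 8 ≤ trainSize n := by
      by_contra hc
      have := lt_five_of_trainSize_lt_eight hm2 (by omega) hj₁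
      omega
    refine (Finset.sum_le_sum fun k _ => h.lintegral_ite_sq_mother_le hπ hρ hρψ hm8 hj₁ hi h1 k
      (hJ _ h2 k)).trans ?_
    rw [hcard _ (by positivity)]
    refine ENNReal.ofReal_le_ofReal ?_
    have hprof : levelDecay s₀ (τ + i - u) ≤ levelProfile s₀ J u j₁ (τ + i) :=
      (levelProfile_bounds s₀ J u j₁ (τ + i)).2.2.2.1 h1
    -- With `j = u + d`, the count `2^j` leaves `2^u 2^(-d/4)`: the rate after division by `m`,
    -- times a summable factor.
    have e : (2 : ℝ) ^ (τ + i) * (2 : ℝ) ^ (-(5 / 4) * ((τ + i - u : ℕ) : ℝ)) =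
        2 ^ u * (2 : ℝ) ^ (-(((τ + i - u : ℕ) : ℝ) / 4)) := by
      rw [← Real.rpow_natCast, ← Real.rpow_natCast, ← Real.rpow_add (by norm_num),
        ← Real.rpow_add (by norm_num), Nat.cast_sub h1.le]
      congr 1
      ring
    calc (2 : ℝ) ^ (τ + i) * (K / trainSize n * (2 : ℝ) ^ (-(5 / 4) * ((τ + i - u : ℕ) : ℝ)))
        = K / trainSize n *
          ((2 : ℝ) ^ (τ + i) * (2 : ℝ) ^ (-(5 / 4) * ((τ + i - u : ℕ) : ℝ))) := by ring
      _ = K * (2 ^ u / trainSize n) * (2 : ℝ) ^ (-(((τ + i - u : ℕ) : ℝ) / 4)) := by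
          rw [e]; ring
      _ ≤ K * (4 * R) * levelDecay s₀ (τ + i - u) := by
          gcongr
          exact quarter_le_levelDecay _ _
      _ = 4 * (0 + K) * R * levelDecay s₀ (τ + i - u) := by ring
      _ ≤ _ := by
          gcongr
          · exact hD _
          · positivity

end NoiseLevels

/-- The thresholded estimator whose thresholds start at the level `u` with
`2 ^ u ≤ n ^ (1 / (2 s + 1)) ≤ 2 ^ (u + 1)` attains the rate `n ^ (-2 s / (2 s + 1))`. -/
theorem lintegral_thresholdEstimator_le {φ ψ : ℝ → ℝ} {τ : ℕ}
    (hwav : IsPeriodizedWaveletBasis φ ψ τ) {Υ : ℝ → ℝ → ℝ} (hΥ : IsThresholdRule Υ)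
    {ρ : ℝ} (hρ : 0 < ρ)
    (hρψ : 4 * Real.log 2 ≤ ρ ^ 2 / (8 + 8 * ρ / (3 * Real.sqrt 2) * (supNorm ψ + 1)))
    (N : ℝ) {L s₀ : ℝ} (hL : 0 < L) (hs₀ : 0 < s₀) :
    ∃ C : ℝ, 0 ≤ C ∧ ∀ (p q : ℝ≥0∞), 1 ≤ p → 1 ≤ q →
      ∀ s : ℝ, (p⁻¹).toReal < s → s₀ ≤ s → s ≤ N → ∀ n : ℕ, 6 ≤ n →
      ∀ j₁ : ℕ, (trainSize n : ℝ) / Real.log (trainSize n) ≤ 2 ^ j₁ →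
        (2 : ℝ) ^ j₁ < 2 * ((trainSize n : ℝ) / Real.log (trainSize n)) →
      ∀ (π : Measure (ℝ × ℝ)) (f : ℝ → ℝ), IsBoundedRegression π f →
        f ∈ besovBall φ ψ τ s p q L →
      ∀ u : ℕ, (2 : ℝ) ^ u ≤ (n : ℝ) ^ (1 / (2 * s + 1)) →
        (n : ℝ) ^ (1 / (2 * s + 1)) ≤ 2 ^ (u + 1) →
      ∫⁻ D, ∫⁻ x, ENNReal.ofReal ((thresholdEstimator φ ψ τ Υ j₁
          (levelThreshold ρ (trainSize n) u) D x - f x) ^ 2) ∂unitVolume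
        ∂(Measure.pi fun _ : Fin (trainSize n) => π) ≤
      ENNReal.ofReal (C * (n : ℝ) ^ (-(2 * s) / (2 * s + 1))) := by
  obtain ⟨hΥm, C₁, C₂, hC₁, hC₂, hΥb⟩ := hΥ
  obtain ⟨J', hJ'⟩ := exists_abs_perWavelet_le hwav.compact_mother hwav.bounded_mother
  set J := max J' 5 with hJdef
  have hJ : ∀ j, J ≤ j → ∀ k, ∀ᵐ x ∂unitVolume,
      |perWavelet ψ j k x| ≤ (2 : ℝ) ^ ((j : ℝ) / 2) * supNorm ψ :=
    fun j hj => hJ' j ((le_max_left _ _).trans hj)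
  -- If `N < s₀` no `s` is admissible; otherwise `N > 0`, which makes the constants nonnegative.
  rcases lt_or_ge N s₀ with hN | hN
  · exact ⟨0, le_rfl, fun p q _ _ s _ hs hsN => absurd (hs.trans hsN) (not_le.2 hN)⟩
  have hN0 : 0 < N := hs₀.trans_le hN
  set Kt := L ^ 2 * (4 / (2 * s₀ / (2 * s₀ + 1))) ^ (2 * N) + L ^ 2 * (4 / (1 / (2 * N + 1)))
    with hKt
  set Kb := L ^ 2 * 2 ^ (2 * N) + (1 + L) ^ 2 * (1 + C₂ * ρ) ^ 2 * (2 : ℝ) ^ (2 * N) * 4 with hKb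
  set Kn := 4 * (2 ^ J + 1024 * (2 + 0.85 * ρ * (supNorm ψ + 1)) ^ 2 / ρ ^ 2) with hKn
  have hKt0 : 0 ≤ Kt := by positivity
  have hKb0 : 0 ≤ Kb := by positivity
  have hKn0 : 0 ≤ Kn := by positivity
  set K := C₁ * (Kb + Kn) + Kt with hK
  set S := ∑' d, levelDecay s₀ d with hS
  have hS0 : 0 ≤ S := tsum_nonneg (levelDecay_nonneg s₀)
  refine ⟨2 ^ τ * 4 + K * (2 + J + 2 * S), by positivity, ?_⟩
  intro p q hp hq s hps hs hsN n hn j₁ hj₁ hj₁' π f hπ hf u hu hu'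
  have hs0 : 0 < s := hs₀.trans_le hs
  have := hπ.isProbability
  obtain ⟨-, hm2, -, -, -⟩ := learnSize_bounds hn
  set m := trainSize n with hm
  have hm0 : 0 < m := by omega
  set P := Measure.pi fun _ : Fin m => π
  set R := (n : ℝ) ^ (-(2 * s) / (2 * s + 1)) with hR
  have hR0 : 0 ≤ R := by positivity
  have hD := levelDecay_nonneg s₀
  have hprof0 : ∀ j, 0 ≤ levelProfile s₀ J u j₁ j := fun j =>
    (levelProfile_bounds s₀ J u j₁ j).1
  have hce : ∀ (g : ℝ → ℝ), Measurable g → ∀ j k : ℕ,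
      Measurable fun D : Fin m → ℝ × ℝ => coeffEstimate g D j k :=
    fun g hg j k => measurable_coeffEstimate hg j k
  have hlam : ∀ j, 0 ≤ levelThreshold ρ m u j := fun j => by unfold levelThreshold; positivity
  have hlevel : ∀ i : ℕ, ∫⁻ D, ∑ k : Fin (2 ^ (τ + i)), ENNReal.ofReal
        (((if τ + i ≤ j₁ then Υ (levelThreshold ρ m u (τ + i)) (coeffEstimate ψ D (τ + i) k) else 0)
          - waveletCoeff ψ f (τ + i) k) ^ 2) ∂P ≤
      ENNReal.ofReal (K * R * levelProfile s₀ J u j₁ (τ + i)) := by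
    intro i
    by_cases hi : τ + i ≤ j₁
    · simp only [if_pos hi]
      have hpt : ∀ (D : Fin m → ℝ × ℝ) (k : Fin (2 ^ (τ + i))), ENNReal.ofReal
          ((Υ (levelThreshold ρ m u (τ + i)) (coeffEstimate ψ D (τ + i) k) -
            waveletCoeff ψ f (τ + i) k) ^ 2) ≤
          ENNReal.ofReal C₁ * (ENNReal.ofReal (min |waveletCoeff ψ f (τ + i) k|
            (C₂ * levelThreshold ρ m u (τ + i)) ^ 2) + ENNReal.ofReal
            (if levelThreshold ρ m u (τ + i) / 2 ≤
              |coeffEstimate ψ D (τ + i) k - waveletCoeff ψ f (τ + i) k| then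
            |coeffEstimate ψ D (τ + i) k - waveletCoeff ψ f (τ + i) k| ^ 2 else 0)) := by
        intro D k
        rw [← ENNReal.ofReal_add (by positivity) (by split_ifs <;> positivity),
          ← ENNReal.ofReal_mul hC₁.le, ← sq_abs]
        exact ENNReal.ofReal_le_ofReal (hΥb _ (hlam _) _ _)
      have hmeas : ∀ k : Fin (2 ^ (τ + i)), Measurable fun D : Fin m → ℝ × ℝ => ENNReal.ofReal
            (if levelThreshold ρ m u (τ + i) / 2 ≤
              |coeffEstimate ψ D (τ + i) k - waveletCoeff ψ f (τ + i) k| then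
            |coeffEstimate ψ D (τ + i) k - waveletCoeff ψ f (τ + i) k| ^ 2 else 0) := by
        intro k
        have h1 : Measurable fun D : Fin m → ℝ × ℝ =>
            |coeffEstimate ψ D (τ + i) k - waveletCoeff ψ f (τ + i) k| :=
          ((hce ψ hwav.measurable_mother (τ + i) k).sub_const _).abs
        exact (Measurable.ite (measurableSet_le measurable_const h1) (h1.pow_const 2)
          measurable_const).ennreal_ofReal
      refine (lintegral_mono fun D => Finset.sum_le_sum fun k _ => hpt D k).trans ?_
      rw [lintegral_finsetSum _ fun k _ => ((hmeas k).const_add _).const_mul _]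
      simp only [lintegral_const_mul' _ _ ENNReal.ofReal_ne_top,
        lintegral_add_left measurable_const, lintegral_const, measure_univ, mul_one,
        ← Finset.mul_sum, Finset.sum_add_distrib]
      have hbias : ∑ k : Fin (2 ^ (τ + i)), ENNReal.ofReal (min |waveletCoeff ψ f (τ + i) k|
            (C₂ * levelThreshold ρ m u (τ + i)) ^ 2) ≤
          ENNReal.ofReal (Kb * R * levelProfile s₀ J u j₁ (τ + i)) := by
        rw [← ENNReal.ofReal_sum_of_nonneg fun _ _ => by positivity]
        refine ENNReal.ofReal_le_ofReal ?_
        rcases le_or_gt (τ + i) u with h1 | h1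
        -- Up to level `u` the threshold vanishes, so the bias term does too.
        · have h2 : levelThreshold ρ m u (τ + i) = 0 := by
            rw [levelThreshold, Nat.sub_eq_zero_of_le h1]; simp
          have h3 : ∀ k : Fin (2 ^ (τ + i)), min |waveletCoeff ψ f (τ + i) k| (C₂ * 0) ^ 2 = 0 :=
            fun k => by rw [mul_zero, min_eq_right (abs_nonneg _), sq, mul_zero]
          have := hprof0 (τ + i)
          rw [h2, Finset.sum_congr rfl fun k _ => h3 k, Finset.sum_const_zero]
          positivity
        · refine (sum_sq_min_threshold_le hn hs₀ hs hsN hL.le hp hq hps hf hu' hρ hC₂ h1).trans ?_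
          gcongr
          exact (levelProfile_bounds s₀ J u j₁ (τ + i)).2.2.2.1 h1
      have hnoise := sum_lintegral_noise_le (s₀ := s₀) hwav hπ hρ hρψ (le_max_right _ _) hJ hn hs0
        hu hj₁' hi
      refine (mul_le_mul_right (add_le_add hbias hnoise) (ENNReal.ofReal C₁)).trans ?_
      have := hprof0 (τ + i)
      rw [← ENNReal.ofReal_add (by positivity) (by positivity), ← ENNReal.ofReal_mul hC₁.le]
      refine ENNReal.ofReal_le_ofReal ?_
      calc _ = C₁ * (Kb + Kn) * R * levelProfile s₀ J u j₁ (τ + i) := by ring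
        _ ≤ _ := by
          gcongr
          exact le_add_of_nonneg_right hKt0
    · simp only [if_neg hi, zero_sub, neg_sq]
      rw [lintegral_const, measure_univ, mul_one,
        ← ENNReal.ofReal_sum_of_nonneg fun _ _ => by positivity]
      refine ENNReal.ofReal_le_ofReal ?_
      refine (sum_sq_coeff_tail_le hn hs₀ hs hsN hL.le hp hq hps hf hj₁ (not_le.1 hi)).trans ?_
      have h1 : levelDecay s₀ (τ + i - j₁) ≤ levelProfile s₀ J u j₁ (τ + i) :=
        (levelProfile_bounds s₀ J u j₁ (τ + i)).2.2.2.2 (not_le.1 hi)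
      have h2 : Kt ≤ K := le_add_of_nonneg_left (by positivity)
      gcongr
      exact hD _
  simp only [hwav.lintegral_sq_thresholdEstimator_sub Υ j₁ _ _ hf.1]
  rw [lintegral_add_left]
  swap
  · exact Finset.measurable_sum _ fun k _ =>
      (((hce φ hwav.measurable_father τ k).sub_const _).pow_const 2).ennreal_ofReal
  rw [lintegral_finsetSum (f := fun (k : Fin (2 ^ τ)) D => ENNReal.ofReal
    ((coeffEstimate φ D τ k - waveletCoeff φ f τ k) ^ 2)) _ fun k _ =>
    (((hce φ hwav.measurable_father τ k).sub_const _).pow_const 2).ennreal_ofReal, lintegral_tsum]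
  swap
  · intro i
    refine (Finset.measurable_sum _ fun k _ => ?_).aemeasurable
    refine Measurable.ennreal_ofReal (Measurable.pow_const (Measurable.sub_const ?_ _) 2)
    split_ifs
    · exact (hΥm _ (hlam _)).comp (hce ψ hwav.measurable_mother _ _)
    · exact measurable_const
  have hfather : ∑ k : Fin (2 ^ τ), ∫⁻ D, ENNReal.ofReal
      ((coeffEstimate φ D τ k - waveletCoeff φ f τ k) ^ 2) ∂P ≤ ENNReal.ofReal (2 ^ τ * 4 * R) := by
    refine (Finset.sum_le_sum fun k _ => hwav.lintegral_sq_father_le hπ hm0 k).trans ?_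
    rw [← ENNReal.ofReal_sum_of_nonneg fun _ _ => by positivity]
    refine ENNReal.ofReal_le_ofReal ?_
    have h1 : 1 / (m : ℝ) ≤ 4 * R := by
      refine le_trans ?_ (two_pow_div_trainSize_le hn hs0 hu)
      gcongr
      exact one_le_pow₀ one_le_two
    simp only [Finset.sum_const, Finset.card_univ, Fintype.card_fin, nsmul_eq_mul]
    push_cast
    rw [mul_assoc]
    gcongr
  refine (add_le_add hfather (ENNReal.tsum_le_tsum hlevel)).trans ?_
  have e : ∀ i, ENNReal.ofReal (K * R * levelProfile s₀ J u j₁ (τ + i)) =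
      ENNReal.ofReal (K * R) * ENNReal.ofReal (levelProfile s₀ J u j₁ (τ + i)) :=
    fun i => ENNReal.ofReal_mul (by positivity)
  simp only [e]
  rw [ENNReal.tsum_mul_left]
  refine (add_le_add le_rfl (mul_le_mul_right (tsum_levelProfile_le hs₀ τ J u j₁) _)).trans ?_
  rw [← ENNReal.ofReal_mul (by positivity), ← ENNReal.ofReal_add (by positivity) (by positivity)]
  refine ENNReal.ofReal_le_ofReal (le_of_eq ?_)
  ring

/-! ### Risk of the multi-thresholding estimator -/

theorem joinSample_castLE {α : Type*} {m l n : ℕ} (h : m + l = n) (D : (Fin m → α) × (Fin l → α))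
    (hle : m ≤ n) (i : Fin m) : joinSample h D (Fin.castLE hle i) = D.1 i := by
  subst h
  exact Fin.append_left D.1 D.2 i

theorem trainSample_joinSample {n : ℕ} (h : trainSize n + learnSize n = n)
    (D : (Fin (trainSize n) → ℝ × ℝ) × (Fin (learnSize n) → ℝ × ℝ)) :
    trainSample (joinSample h D) = D.1 :=
  funext fun i => joinSample_castLE h D _ i

theorem sum_filter_joinSample {α : Type*} {m l n : ℕ} (h : m + l = n)
    (D : (Fin m → α) × (Fin l → α)) (F : α → ℝ) :
    ∑ i ∈ Finset.univ.filter (fun i : Fin n => m ≤ (i : ℕ)), F (joinSample h D i) =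
      ∑ i, F (D.2 i) := by
  subst h
  rw [Finset.sum_filter, Fin.sum_univ_add]
  simp only [joinSample, Fin.cast_eq_self, Fin.append_left, Fin.append_right, Fin.val_castAdd,
    Fin.val_natAdd, Nat.le_add_right, if_true]
  rw [Finset.sum_eq_zero fun i _ => if_neg (not_le.2 i.2), zero_add]

theorem measurable_thresholdEstimator {φ ψ : ℝ → ℝ} (hφ : Measurable φ) (hψ : Measurable ψ)
    (τ : ℕ) (Υ : ℝ → ℝ → ℝ) (j₁ : ℕ) (lam : ℕ → ℝ) {m : ℕ} (D : Fin m → ℝ × ℝ) :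
    Measurable (thresholdEstimator φ ψ τ Υ j₁ lam D) := by
  have h1 := fun j k => measurable_perWavelet hφ j k
  have h2 := fun j k => measurable_perWavelet hψ j k
  unfold thresholdEstimator
  fun_prop

theorem sq_clip_sub_le {y z : ℝ} (hz : z ∈ Icc (0 : ℝ) 1) : (clip 0 1 y - z) ^ 2 ≤ (y - z) ^ 2 := by
  obtain ⟨h0, h1⟩ := hz
  unfold clip
  rcases le_total y 1 with h | h
  · rw [min_eq_left h]
    rcases le_total 0 y with h' | h'
    · rw [max_eq_right h']
    · rw [max_eq_left h']; nlinarith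
  · rw [min_eq_right h, max_eq_right zero_le_one]; nlinarith

/-- With the training sample frozen, the oracle inequality applies to the learning sample alone.
Clipping only helps, since `f` takes values in `[0,1]` almost everywhere. -/
theorem estimationRisk_multiThresholdEstimator_le {φ ψ : ℝ → ℝ} {τ : ℕ} (hφ : Measurable φ)
    (hψ : Measurable ψ) (Υ : ℝ → ℝ → ℝ) (ρ : ℝ) (j₁ : ℕ) {π : Measure (ℝ × ℝ)} {f : ℝ → ℝ}
    (hπ : IsBoundedRegression π f) {n : ℕ} (hn : 6 ≤ n) {u : ℕ} (hu : u ∈ levelGrid n) :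
    estimationRisk π n f (multiThresholdEstimator φ ψ τ Υ ρ j₁) ≤
      2 * ∫⁻ D, ∫⁻ x, ENNReal.ofReal ((thresholdEstimator φ ψ τ Υ j₁
          (levelThreshold ρ (trainSize n) u) D x - f x) ^ 2) ∂unitVolume
        ∂(Measure.pi fun _ : Fin (trainSize n) => π) +
      ENNReal.ofReal (18 * ((levelGrid n).card / learnSize n)) := by
  have := hπ.isProbability
  obtain ⟨hsum, -, -, hl0, -⟩ := learnSize_bounds hn
  refine (lintegral_pi_le_of_joinSample hsum π _ (fun D => 2 * (∫⁻ x, ENNReal.ofReal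
    ((thresholdEstimator φ ψ τ Υ j₁ (levelThreshold ρ (trainSize n) u) D x - f x) ^ 2)
    ∂unitVolume) + ENNReal.ofReal (18 * ((levelGrid n).card / learnSize n)))
    fun D₁ => ?_).trans_eq ?_
  · set g : ℕ → ℝ → ℝ := fun v x => clip 0 1 (thresholdEstimator φ ψ τ Υ j₁
      (levelThreshold ρ (trainSize n) v) D₁ x) with hg
    have hbase : ∀ D₂, baseEstimator φ ψ τ Υ ρ j₁ (joinSample hsum (D₁, D₂)) = g := fun D₂ => by
      ext v x
      simp only [baseEstimator, trainSample_joinSample, hg]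
    have hgm : ∀ v, Measurable (g v) := fun v => by
      have := measurable_thresholdEstimator hφ hψ τ Υ j₁ (levelThreshold ρ (trainSize n) v) D₁
      simp only [hg, clip]
      fun_prop
    have hg01 : ∀ v x, g v x ∈ Icc (0 : ℝ) 1 := fun v x =>
      ⟨le_max_left _ _, max_le zero_le_one (min_le_right _ _)⟩
    have horacle := hπ.lintegral_softmax_le hl0 (levelGrid n) g hgm hg01 hu
      (fun v D₂ => learnRisk (joinSample hsum (D₁, D₂)) (g v)) (fun v D₂ => by
        simp only [learnRisk]
        rw [sum_filter_joinSample hsum (D₁, D₂) fun z => (z.2 - g v z.1) ^ 2])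
    simp only [multiThresholdEstimator, aggWeight, hbase]
    refine horacle.trans ?_
    gcongr 2 * ?_ + _
    refine lintegral_mono_ae ?_
    filter_upwards [hπ.regression_mem_Icc] with x hx
    exact ENNReal.ofReal_le_ofReal (sq_clip_sub_le hx)
  · rw [lintegral_add_right _ measurable_const, lintegral_const_mul' _ _ (by simp)]
    simp

theorem mainTheorem5 (φ ψ : ℝ → ℝ) (τ : ℕ) (hwav : IsPeriodizedWaveletBasis φ ψ τ)
    (Υ : ℝ → ℝ → ℝ) (hΥ : IsThresholdRule Υ)
    (ρ : ℝ) (hρ : 0 < ρ)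
    (hρψ : 4 * Real.log 2 ≤
      ρ ^ 2 / (8 + 8 * ρ / (3 * Real.sqrt 2) * (supNorm ψ + 1)))
    (N L s₀ : ℝ) (hL : 0 < L) (hs₀ : 0 < s₀) :
    ∃ C : ℝ, 0 < C ∧
      ∀ (p q : ℝ≥0∞), 1 ≤ p → 1 ≤ q →
      ∀ s : ℝ, (p⁻¹).toReal < s → s₀ ≤ s → s ≤ N →
      ∀ n : ℕ, 6 ≤ n →
      ∀ j₁ : ℕ, (trainSize n : ℝ) / Real.log (trainSize n) ≤ 2 ^ j₁ →
        (2 : ℝ) ^ j₁ < 2 * ((trainSize n : ℝ) / Real.log (trainSize n)) →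
      ∀ (π : Measure (ℝ × ℝ)) (f : ℝ → ℝ), IsBoundedRegression π f →
        f ∈ besovBall φ ψ τ s p q L →
        estimationRisk π n f (multiThresholdEstimator φ ψ τ Υ ρ j₁)
          ≤ ENNReal.ofReal (C * (n : ℝ) ^ (-(2 * s) / (2 * s + 1))) := by
  obtain ⟨C, hC, hrisk⟩ := lintegral_thresholdEstimator_le hwav hΥ hρ hρψ N hL hs₀
  -- The factors `2` and `18` come from the oracle inequality; the final `1` only makes the constant
  -- strictly positive.
  refine ⟨2 * C + 18 * (3 * (2 * (2 * N + 1)) ^ 2) + 1, by positivity, ?_⟩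
  intro p q hp hq s hps hs hsN n hn j₁ hj₁ hj₁' π f hπ hf
  have hs0 : 0 < s := hs₀.trans_le hs
  obtain ⟨u, hu, hu1, hu2⟩ := exists_level hn hs0
  refine (estimationRisk_multiThresholdEstimator_le hwav.measurable_father hwav.measurable_mother
    Υ ρ j₁ hπ hn hu).trans ?_
  have h1 := hrisk p q hp hq s hps hs hsN n hn j₁ hj₁ hj₁' π f hπ hf u hu1 hu2
  have h2 := card_grid_div_learnSize_le hn hs0 hsN
  set R := (n : ℝ) ^ (-(2 * s) / (2 * s + 1)) with hR
  have hR0 : 0 ≤ R := by positivity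
  refine (add_le_add (mul_le_mul_right h1 2) (ENNReal.ofReal_le_ofReal
    (mul_le_mul_of_nonneg_left h2 (by norm_num)))).trans ?_
  rw [show (2 : ℝ≥0∞) = ENNReal.ofReal 2 by simp, ← ENNReal.ofReal_mul (by norm_num),
    ← ENNReal.ofReal_add (by positivity) (by positivity)]
  refine ENNReal.ofReal_le_ofReal ?_
  linarith
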